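/- Let $n\ge 0$, and let $R$ be a countable Boolean ring (not necessarily with an identity) with distinguished ideals $J_1,\dots,J_n$, such that the system $(R,J_1,\dots,J_n)$ is $\omega$-categorical, i.e. every countable structure (in the language of Boolean rings with $n$ unary predicates) that is elementarily equivalent to $(R,J_1,\dots,J_n)$ is isomorphic to it. Let $X$ be the Stone space of $R$, with $R$ identified with the ring of compact open subsets of $X$, and let $C_i = X\setminus\bigcup_{A\in J_i}A$ be the closed set corresponding to $J_i$. Let $\mathscr{C}$ be the closure subalgebra of $2^X$ generated by $C_1,\dots,C_n$, i.e. the least Boolean subalgebra of $2^X$ that contains every $C_i$ and is closed under topological closure; it is regarded as a closure algebra with distinguished elements $C_1,\dots,C_n$. Then every atom of $\mathscr{C}$ has only finitely many isolated points (in its subspace topology). For an atom $D$ of $\mathscr{C}$ let $h(D)\in\mathbb{N}$ be the number of isolated points of $D$, and let $k(D)=0$ if $D$ is finite, $k(D)=1$ if $D$ is infinite but bounded (i.e. $\overline{D}$ is compact), and $k(D)=2$ if $D$ is unbounded (i.e. $\overline{D}$ is not compact). Then $(R,J_1,\dots,J_n)$ is determined up to isomorphism by the isomorphism class of the tuple $\{\mathscr{C},h,k\}$.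 That is, let $(R,J_1,\dots,J_n)$ and $(S,K_1,\dots,K_n)$ be two such $\omega$-categorical systems with tuples $\{\mathscr{C},h,k\}$ and $\{\mathscr{E},h',k'\}$ and distinguished elements $C_1,\dots,C_n$ and $E_1,\dots,E_n$. If there is a Boolean algebra isomorphism $\theta:\mathscr{C}\to\mathscr{E}$ such that $\theta(\overline{A})=\overline{\theta(A)}$ for all $A\in\mathscr{C}$, $\theta(C_i)=E_i$ for all $i$, and $h'(\theta(D))=h(D)$, $k'(\theta(D))=k(D)$ for all atoms $D$ of $\mathscr{C}$, then there is a ring isomorphism $R\to S$ that maps $J_i$ onto $K_i$ for every $i$. -/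

import Mathlib

universe u v w

/-! ### Boolean rings and their Stone spaces -/

/-- A Boolean ring, possibly without an identity: every element is idempotent. -/
class NonUnitalBooleanRing (R : Type u) extends NonUnitalRing R where
  isIdempotentElem (a : R) : IsIdempotentElem a

/-- The Stone space of a Boolean ring: its points are the prime ideals. -/
structure StoneSpace (R : Type u) [NonUnitalBooleanRing R] where
  ideal : TwoSidedIdeal R
  ne_top : ideal ≠ ⊤
  mem_or_mem : ∀ a b : R, a * b ∈ ideal → a ∈ ideal ∨ b ∈ ideal

namespace StoneSpace

variable {R : Type u} [NonUnitalBooleanRing R]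

/-- The compact open subset of the Stone space that corresponds to the ring element `a`. -/
def basicOpen (a : R) : Set (StoneSpace R) := {x | a ∉ x.ideal}

/-- The Stone topology, with the sets `basicOpen a` as basic open sets. -/
instance : TopologicalSpace (StoneSpace R) :=
  TopologicalSpace.generateFrom (Set.range (basicOpen (R := R)))

/-- The closed subset of the Stone space that corresponds to an ideal `J`: the complement of the
union of the compact open sets that belong to `J`. -/
def closedSet (J : TwoSidedIdeal R) : Set (StoneSpace R) := (⋃ a ∈ J, basicOpen a)ᶜ

end StoneSpace

/-! ### Boolean ring systems as first-order structures, and categoricity -/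

/-- Function symbols of the language of Boolean rings: `0`, `+` and `*`. -/
inductive BoolRingFunc : ℕ → Type
  | zero : BoolRingFunc 0
  | add : BoolRingFunc 2
  | mul : BoolRingFunc 2

/-- Relation symbols: `n` unary predicates for the distinguished ideals. -/
inductive IdealPred (n : ℕ) : ℕ → Type
  | mem (i : Fin n) : IdealPred n 1

/-- The first-order language of Boolean rings with `n` distinguished ideals. -/
def systemLanguage (n : ℕ) : FirstOrder.Language where
  Functions := BoolRingFunc
  Relations := IdealPred n

/-- The system `(R, J₁, …, Jₙ)` as a first-order structure. -/
@[reducible] def systemStructure {R : Type u} [NonUnitalBooleanRing R] {n : ℕ} (J : Fin n → TwoSidedIdeal R) :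
    (systemLanguage n).Structure R where
  funMap := fun {_} f =>
    match f with
    | .zero => fun _ => 0
    | .add => fun x => x 0 + x 1
    | .mul => fun x => x 0 * x 1
  RelMap := fun {_} r =>
    match r with
    | .mem i => fun x => x 0 ∈ J i

/-- A countable structure is `ω`-categorical if it is determined up to isomorphism, among the
countable structures, by its first-order properties. -/
def IsOmegaCategorical (L : FirstOrder.Language.{0, 0}) (M : Type w) [L.Structure M] : Prop :=
  Countable M ∧ ∀ (N : Type w) [L.Structure N], Countable N →
    L.ElementarilyEquivalent M N → Nonempty (L.Equiv M N)

/-- The system `(R, J₁, …, Jₙ)` is countable and `ω`-categorical. -/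
def IsOmegaCategoricalSystem {R : Type u} [NonUnitalBooleanRing R] {n : ℕ}
    (J : Fin n → TwoSidedIdeal R) : Prop :=
  @IsOmegaCategorical (systemLanguage n) R (systemStructure J)

/-- Isomorphisms of Boolean rings with `n` distinguished ideals. -/
structure SystemIso {R : Type u} {S : Type v} [NonUnitalBooleanRing R] [NonUnitalBooleanRing S]
    {n : ℕ} (J : Fin n → TwoSidedIdeal R) (K : Fin n → TwoSidedIdeal S) where
  toRingEquiv : R ≃+* S
  mem_iff : ∀ (i : Fin n) (a : R), a ∈ J i ↔ toRingEquiv a ∈ K i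

/-! ### The closure algebra generated by subsets of a topological space -/

section ClosureAlgebra

variable {X : Type u} [TopologicalSpace X] {n : ℕ}

/-- The closure subalgebra of the power set of `X` generated by `C₁, …, Cₙ`: the least Boolean
subalgebra that contains each `Cᵢ` and is closed under topological closure. -/
def generatedClosureAlgebra (C : Fin n → Set X) : BooleanSubalgebra (Set X) :=
  sInf {L | (∀ i, C i ∈ L) ∧ ∀ A ∈ L, closure A ∈ L}

theorem mem_generatedClosureAlgebra (C : Fin n → Set X) (i : Fin n) :
    C i ∈ generatedClosureAlgebra C := by
  simp only [generatedClosureAlgebra, BooleanSubalgebra.mem_sInf]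
  exact fun L hL => hL.1 i

theorem closure_mem_generatedClosureAlgebra (C : Fin n → Set X) {A : Set X}
    (hA : A ∈ generatedClosureAlgebra C) : closure A ∈ generatedClosureAlgebra C := by
  simp only [generatedClosureAlgebra, BooleanSubalgebra.mem_sInf] at hA ⊢
  exact fun L hL => hL.2 A (hA L hL)

/-- The distinguished element `Cᵢ` of the closure algebra generated by `C₁, …, Cₙ`. -/
def generator (C : Fin n → Set X) (i : Fin n) : generatedClosureAlgebra C :=
  ⟨C i, mem_generatedClosureAlgebra C i⟩

/-- The closure operator of the closure algebra generated by `C₁, …, Cₙ`. -/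
def closureOp (C : Fin n → Set X) (A : generatedClosureAlgebra C) : generatedClosureAlgebra C :=
  ⟨closure (A : Set X), closure_mem_generatedClosureAlgebra C A.2⟩

/-- The isolated points of a subset `D`, for the subspace topology of `D`. -/
def isolatedPoints (D : Set X) : Set X := D \ derivedSet D

/-- The number of isolated points of `D`. -/
noncomputable def numIsolated (D : Set X) : ℕ := (isolatedPoints D).ncard

open Classical in
/-- `0` if `D` is finite, `1` if `D` is infinite but bounded (its closure is compact),
`2` if `D` is unbounded. -/
noncomputable def sizeType (D : Set X) : Fin 3 :=
  if D.Finite then 0 else if IsCompact (closure D) then 1 else 2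

end ClosureAlgebra

/-- Isomorphisms between the tuples `{𝒞, h, k}` that belong to `C` and to `E`: isomorphisms of the
generated closure algebras that preserve the distinguished elements, and the functions `h`
(number of isolated points) and `k` (size type) on atoms. -/
structure ClosureDataIso {X : Type u} {Y : Type v} [TopologicalSpace X] [TopologicalSpace Y]
    {n : ℕ} (C : Fin n → Set X) (E : Fin n → Set Y) where
  toOrderIso : generatedClosureAlgebra C ≃o generatedClosureAlgebra E
  map_closureOp : ∀ A, toOrderIso (closureOp C A) = closureOp E (toOrderIso A)
  map_generator : ∀ i, toOrderIso (generator C i) = generator E i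
  map_numIsolated : ∀ D, IsAtom D →
    numIsolated (toOrderIso D : Set Y) = numIsolated (D : Set X)
  map_sizeType : ∀ D, IsAtom D →
    sizeType (toOrderIso D : Set Y) = sizeType (D : Set X)

/-!
The proof has two independent halves.

*Finiteness.* A countable `ω`-categorical structure has only finitely many orbits of elements under
automorphisms (`IsOmegaCategorical.finite_range_of_invariant`, the part of the Ryll-Nardzewski
theorem that is needed). By compactness such a structure realizes every finitely satisfiable family
of formulas, so tuples isolated by a single formula are dense; a generic union of finite sets
enumerated by isolated tuples is an elementary substructure, hence isomorphic to the whole, so that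
all tuples are isolated. By compactness again finitely many isolating formulas cover all elements,
and elements satisfying the same isolating formula are conjugate by back and forth.

For a Boolean ring system, automorphisms act on the Stone space by homeomorphisms that fix every
member of the closure algebra. A closed set is determined by the ideal of the compact open sets
disjoint from it, and an invariant ideal is a union of orbits; so there are finitely many invariant
closed sets, and the closure algebra is finite. Moreover, if a member `D` of the closure algebra had
infinitely many isolated points, the number of points in `A ∩ D`, for compact open `A`, would be an
invariant with infinitely many values.

*Classification.* The atoms `D i` of the finite closure algebra partition the space, and the closure
of each is a union of atoms. Corresponding atoms `D i` and `E i` of the two systems have the same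
number of isolated points and the same closure relations. Call clopen sets `A` and `B` similar
(`IsSimilar`) if for each `i` they contain equally many isolated points of `D i` and `E i`, and both
or neither contain accumulation points. The key step, `IsSimilar.exists_split`, is that a splitting
of `A` can be copied to any similar `B`: an atom all of whose accumulation points in `A` fall into
one part forces a closed subset of `B` into the corresponding part; the closed sets forced into the
two parts are disjoint, and one of them is compact, because corresponding atoms are bounded
simultaneously. So a compact open set separates them. Starting from the similarity of the two whole
spaces, back and forth yields an isomorphism of the countable rings of compact open sets that
respects every union of atoms, in particular the closed sets of the distinguished ideals.
-/

/-! ### Back and forth -/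

/-- Back-and-forth: if every pair-set in `G` can be extended on either side by any element, then
some bijection between the two countable types is, on every finite set, contained in a member of
`G`, and it can be chosen to contain a prescribed member. -/
theorem exists_equiv_of_back_and_forth {α : Type u} {β : Type v} [Countable α] [Countable β]
    (G : Set (Finset (α × β)))
    (hinj : ∀ s ∈ G, ∀ p ∈ s, ∀ q ∈ s, p.1 = q.1 ↔ p.2 = q.2)
    (forth : ∀ s ∈ G, ∀ a, ∃ b, ∃ t ∈ G, s ⊆ t ∧ (a, b) ∈ t)
    (back : ∀ s ∈ G, ∀ b, ∃ a, ∃ t ∈ G, s ⊆ t ∧ (a, b) ∈ t)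
    {s₀ : Finset (α × β)} (h₀ : s₀ ∈ G) :
    ∃ e : α ≃ β, (∀ p ∈ s₀, e p.1 = p.2) ∧
      ∀ t : Finset α, ∃ s ∈ G, ∀ a ∈ t, (a, e a) ∈ s := by
  classical
  cases nonempty_encodable α
  cases nonempty_encodable β
  let 𝒟 : α ⊕ β → Order.Cofinal G := Sum.elim
    (fun a => ⟨{s | ∃ b, (a, b) ∈ s.1}, fun s => by
      obtain ⟨b, t, ht, hst, hab⟩ := forth s.1 s.2 a
      exact ⟨⟨t, ht⟩, ⟨b, hab⟩, hst⟩⟩)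
    (fun b => ⟨{s | ∃ a, (a, b) ∈ s.1}, fun s => by
      obtain ⟨a, t, ht, hst, hab⟩ := back s.1 s.2 b
      exact ⟨⟨t, ht⟩, ⟨a, hab⟩, hst⟩⟩)
  let I : Order.Ideal G := Order.idealOfCofinals ⟨s₀, h₀⟩ 𝒟
  have hF : ∀ a, ∃ b, ∃ s ∈ I, (a, b) ∈ s.1 := fun a => by
    obtain ⟨s, ⟨b, hb⟩, hs⟩ := Order.cofinal_meets_idealOfCofinals ⟨s₀, h₀⟩ 𝒟 (Sum.inl a)
    exact ⟨b, s, hs, hb⟩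
  have hB : ∀ b, ∃ a, ∃ s ∈ I, (a, b) ∈ s.1 := fun b => by
    obtain ⟨s, ⟨a, ha⟩, hs⟩ := Order.cofinal_meets_idealOfCofinals ⟨s₀, h₀⟩ 𝒟 (Sum.inr b)
    exact ⟨a, s, hs, ha⟩
  choose F hF using hF
  choose B hB using hB
  have key : ∀ {a a' b b'}, (∃ s ∈ I, (a, b) ∈ s.1) → (∃ s ∈ I, (a', b') ∈ s.1) →
      (a = a' ↔ b = b') := by
    rintro a a' b b' ⟨s, hs, h⟩ ⟨t, ht, h'⟩
    obtain ⟨r, -, hr, hr'⟩ := I.directed s hs t ht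
    exact hinj r.1 r.2 _ (hr h) _ (hr' h')
  refine ⟨⟨F, B, fun a => (key (hB (F a)) (hF a)).2 rfl, fun b => (key (hF (B b)) (hB b)).1 rfl⟩,
    fun p hp => ?_, fun t => ?_⟩
  · exact (key (hF p.1) ⟨_, Order.mem_idealOfCofinals _ _, hp⟩).1 rfl
  · suffices ∃ s ∈ I, ∀ a ∈ t, (a, F a) ∈ s.1 from
      let ⟨s, _, h⟩ := this; ⟨s.1, s.2, h⟩
    induction t using Finset.induction with
    | empty => exact ⟨⟨s₀, h₀⟩, Order.mem_idealOfCofinals _ _, by simp⟩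
    | insert a t _ ih =>
      obtain ⟨s, hs, h⟩ := ih
      obtain ⟨s', hs', h'⟩ := hF a
      obtain ⟨r, hrI, hr, hr'⟩ := I.directed s hs s' hs'
      refine ⟨r, hrI, fun b hb => ?_⟩
      obtain rfl | hb := Finset.mem_insert.1 hb
      exacts [hr' h', hr (h b hb)]

/-! ### Countable categoricity: realized families and isolated tuples -/

section Categoricity

open FirstOrder FirstOrder.Language

variable {L : FirstOrder.Language.{0, 0}} {M : Type w} [L.Structure M]

/-- A countable `ω`-categorical structure realizes every family of formulas that is finitely
satisfiable in it. -/
theorem IsOmegaCategorical.exists_realize_of_finitely_satisfiable [Countable L.Symbols]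
    [Nonempty M] (h : IsOmegaCategorical L M) {α : Type u} [Countable α] (Φ : Set (L.Formula α))
    (hΦ : ∀ Ψ : Finset (L.Formula α), ↑Ψ ⊆ Φ → ∃ v : α → M, ∀ φ ∈ Ψ, φ.Realize v) :
    ∃ v : α → M, ∀ φ ∈ Φ, φ.Realize v := by
  classical
  -- the valid formulas contain the theory of `M`
  let V : Set (L.Formula α) := {φ | ∀ v : α → M, φ.Realize v}
  let T : L[[α]].Theory := Formula.equivSentence '' (Φ ∪ V)
  have hT : T.IsSatisfiable := by
    rw [Theory.isSatisfiable_iff_isFinitelySatisfiable]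
    intro T₀ hT₀
    obtain ⟨v, hv⟩ := hΦ ((T₀.image Formula.equivSentence.symm).filter (· ∈ Φ))
      (fun φ hφ => (Finset.mem_filter.1 hφ).2)
    let := constantsOn.structure v
    have : M ⊨ (↑T₀ : L[[α]].Theory) := by
      refine ⟨fun σ hσ => ?_⟩
      rw [← Formula.equivSentence.apply_symm_apply σ, Formula.realize_equivSentence]
      obtain ⟨φ, hφ | hφ, rfl⟩ := hT₀ hσ
      · refine hv _ (Finset.mem_filter.2 ⟨Finset.mem_image_of_mem _ hσ, ?_⟩)
        simpa using hφ
      · simpa using hφ _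
    exact Theory.Model.isSatisfiable M
  -- a countable model of `T`, in the universe of `M`
  obtain ⟨N, sN, hN, hNT⟩ : ∃ (N : Type w) (_ : L[[α]].Structure N), Countable N ∧ N ⊨ T := by
    obtain ⟨N⟩ := hT
    cases finite_or_infinite N with
    | inl _ =>
      obtain ⟨k, ⟨e⟩⟩ := Finite.exists_equiv_fin N
      let e' : N ≃ ULift.{w} (Fin k) := e.trans Equiv.ulift.symm
      let : L[[α]].Structure (ULift.{w} (Fin k)) := e'.inducedStructure
      exact ⟨ULift.{w} (Fin k), inferInstance, inferInstance,
        StrongHomClass.theory_model e'.inducedStructureEquiv⟩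
    | inr _ =>
      obtain ⟨N', hN', hc⟩ := exists_elementarilyEquivalent_card_eq L[[α]] N Cardinal.aleph0.{w}
        le_rfl (by
          rw [Cardinal.lift_aleph0, Cardinal.lift_le_aleph0, Language.card,
            Cardinal.mk_le_aleph0_iff]
          infer_instance)
      exact ⟨N', N'.str, Cardinal.mk_le_aleph0_iff.1 hc.le, hN'.theory_model⟩
  let : L.Structure N := (L.lhomWithConstants α).reduct N
  have : (L.lhomWithConstants α).IsExpansionOn N := LHom.isExpansionOn_reduct _ _
  let c : α → N := fun a => (L.con a : N)
  have hc : ∀ φ ∈ Φ ∪ V, φ.Realize c := fun φ hφ =>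
    (Formula.realize_equivSentence N φ).1 (hNT.realize_of_mem _ ⟨φ, hφ, rfl⟩)
  have hsent : ∀ σ : L.Sentence, M ⊨ σ → N ⊨ σ := fun σ hσ => by
    have := hc (Formula.relabel (Empty.elim : Empty → α) σ) (Or.inr fun v => by
      rw [Formula.realize_relabel]
      rw [show v ∘ Empty.elim = default from Subsingleton.elim _ _]
      exact hσ)
    rw [Formula.realize_relabel,
      show c ∘ Empty.elim = default from Subsingleton.elim _ _] at this
    exact this
  obtain ⟨e⟩ := h.2 N hN (elementarilyEquivalent_iff.2 fun σ =>
    ⟨hsent σ, fun hσ => by_contra fun hn => hsent σ.not hn hσ⟩)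
  exact ⟨e.symm ∘ c, fun φ hφ =>
    (StrongHomClass.realize_formula e.symm φ).2 (hc φ (Or.inl hφ))⟩

/-- A tuple is isolated if a single formula implies all formulas that hold of the tuple. -/
def IsIsolated (L : FirstOrder.Language.{0, 0}) {M : Type w} [L.Structure M] {α : Type u}
    (v : α → M) : Prop :=
  ∃ χ : L.Formula α, χ.Realize v ∧
    ∀ w : α → M, χ.Realize w → ∀ φ : L.Formula α, φ.Realize v → φ.Realize w

/-- If one tuple satisfies all formulas that hold of another, the two satisfy the same formulas. -/
theorem realize_iff_of_forall_realize {α : Type u} {v w : α → M}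
    (h : ∀ φ : L.Formula α, φ.Realize v → φ.Realize w) (φ : L.Formula α) :
    φ.Realize v ↔ φ.Realize w :=
  ⟨h φ, fun hw => by_contra fun hv => h φ.not hv hw⟩

theorem IsIsolated.comp {α : Type u} {β : Type v} [Finite α] [Finite β] {v : α → M}
    (hv : IsIsolated L v) (f : β → α) : IsIsolated L (v ∘ f) := by
  obtain ⟨χ, hχ, hv⟩ := hv
  let ψ : L.Formula (β ⊕ α) := χ.relabel Sum.inr ⊓
    Formula.iInf fun b : β => (Term.var (Sum.inl b)).equal (Term.var (Sum.inr (f b)))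
  refine ⟨ψ.iExs α, ?_, fun w hw φ hφ => ?_⟩
  · rw [Formula.realize_iExs]
    refine ⟨v, ?_⟩
    simp [ψ, Formula.realize_inf, Formula.realize_relabel, Formula.realize_iInf,
      Formula.realize_equal, hχ, Sum.elim_comp_inr]
  · rw [Formula.realize_iExs] at hw
    obtain ⟨x, hx⟩ := hw
    simp only [ψ, Formula.realize_inf, Formula.realize_relabel, Formula.realize_iInf,
      Formula.realize_equal, Sum.elim_comp_inr, Term.realize_var, Sum.elim_inl,
      Sum.elim_inr] at hx
    have := hv x hx.1 (φ.relabel f) (by rwa [Formula.realize_relabel])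
    rw [Formula.realize_relabel] at this
    rwa [show w = x ∘ f from funext hx.2]

/-- Isolated tuples are dense. Otherwise, below some formula, one can exclude the countably many
tuples one after another, and the resulting decreasing sequence of formulas would be realized. -/
theorem IsOmegaCategorical.exists_isIsolated [Countable L.Symbols] [Nonempty M]
    (h : IsOmegaCategorical L M) {α : Type u} [Finite α] (φ : L.Formula α)
    (hφ : ∃ v : α → M, φ.Realize v) : ∃ v : α → M, φ.Realize v ∧ IsIsolated L v := by
  by_contra! hno
  have := h.1
  obtain ⟨m, hm⟩ := exists_surjective_nat (α → M)
  let P := {ψ : L.Formula α // (∃ v : α → M, ψ.Realize v) ∧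
    ∀ v : α → M, ψ.Realize v → φ.Realize v}
  have step : ∀ (ψ : P) (c : α → M), ∃ ψ' : P,
      (∀ v : α → M, ψ'.1.Realize v → ψ.1.Realize v) ∧ ¬ ψ'.1.Realize c := by
    rintro ⟨ψ, hψ, hψφ⟩ c
    by_cases hc : ψ.Realize c
    · have := hno c (hψφ c hc)
      simp only [IsIsolated, not_exists, not_and, not_forall] at this
      obtain ⟨b, hb, θ, hθc, hθb⟩ := this ψ hc
      refine ⟨⟨ψ ⊓ θ.not, ⟨b, ?_⟩, fun v hv => hψφ v ?_⟩, fun v hv => ?_, fun hv => ?_⟩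
      · exact Formula.realize_inf.2 ⟨hb, hθb⟩
      · exact (Formula.realize_inf.1 hv).1
      · exact (Formula.realize_inf.1 hv).1
      · exact (Formula.realize_inf.1 hv).2 hθc
    · exact ⟨⟨ψ, hψ, hψφ⟩, fun v hv => hv, hc⟩
  choose F hF hFc using step
  -- the formula at stage `k + 1` excludes the tuple `m k`
  let s : ℕ → P := fun n => Nat.rec ⟨φ, hφ, fun _ => id⟩ (fun k ψ => F ψ (m k)) n
  have hmono : ∀ i j, i ≤ j → ∀ v : α → M, (s j).1.Realize v → (s i).1.Realize v := by
    intro i j hij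
    induction hij with
    | refl => exact fun v => id
    | step _ ih => exact fun v hv => ih v (hF _ _ v hv)
  obtain ⟨v, hv⟩ := h.exists_realize_of_finitely_satisfiable (Set.range fun n => (s n).1)
    (fun Ψ hΨ => by
      choose! g hg using hΨ
      obtain ⟨v, hv⟩ := (s (Ψ.sup g)).2.1
      refine ⟨v, fun ψ hψ => ?_⟩
      rw [← hg hψ]
      exact hmono _ _ (Finset.le_sup hψ) v hv)
  obtain ⟨k, rfl⟩ := hm v
  exact hFc (s k) (m k) (hv _ ⟨k + 1, rfl⟩)

/-- An isolated tuple can be extended by a witness of a given formula to an isolated tuple. -/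
theorem IsOmegaCategorical.exists_isIsolated_sumElim [Countable L.Symbols]
    (h : IsOmegaCategorical L M) {α : Type u} [Finite α] {v : α → M} (hv : IsIsolated L v)
    (φ : L.Formula (α ⊕ Fin 1)) {c : Fin 1 → M} (hc : φ.Realize (Sum.elim v c)) :
    ∃ d : Fin 1 → M, φ.Realize (Sum.elim v d) ∧ IsIsolated L (Sum.elim v d) := by
  have : Nonempty M := ⟨c 0⟩
  obtain ⟨χ, hχ, hv⟩ := hv
  obtain ⟨b, hb, θ, hθ, hbθ⟩ := h.exists_isIsolated (φ ⊓ χ.relabel Sum.inl) ⟨Sum.elim v c, by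
    simp [Formula.realize_inf, Formula.realize_relabel, hc, hχ]⟩
  rw [Formula.realize_inf, Formula.realize_relabel] at hb
  have hbv := (realize_iff_of_forall_realize (hv _ hb.2) ((φ ⊓ θ).iExs (Fin 1))).2 (by
    rw [Formula.realize_iExs]
    exact ⟨b ∘ Sum.inr, by simpa [Formula.realize_inf] using ⟨hb.1, hθ⟩⟩)
  rw [Formula.realize_iExs] at hbv
  obtain ⟨d, hd⟩ := hbv
  rw [Formula.realize_inf] at hd
  refine ⟨d, hd.1, θ, hd.2, fun w hw ψ hψ => hbθ w hw ψ ?_⟩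
  exact (realize_iff_of_forall_realize (hbθ _ hd.2) ψ).2 hψ

end Categoricity

/-! ### Automorphism orbits of a countably categorical structure -/

section Orbits

open FirstOrder FirstOrder.Language

variable {L : FirstOrder.Language.{0, 0}} {M : Type w} [L.Structure M]

/-- In a countable `ω`-categorical structure all finite tuples are isolated: a generic union of
finite sets enumerated by isolated tuples is an elementary substructure, and it is isomorphic to
the whole structure. -/
theorem IsOmegaCategorical.isIsolated [Countable L.Symbols] [Nonempty M]
    (h : IsOmegaCategorical L M) {α : Type u} [Finite α] (v : α → M) : IsIsolated L v := by
  classical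
  have := h.1
  let P := {s : Finset M // IsIsolated L (Subtype.val : s → M)}
  have hempty : IsIsolated L (Subtype.val : (∅ : Finset M) → M) := by
    obtain ⟨v, -, hv⟩ := h.exists_isIsolated (⊤ : L.Formula (∅ : Finset M))
      ⟨Subtype.val, Formula.realize_top.2 trivial⟩
    rwa [Subsingleton.elim (Subtype.val : (∅ : Finset M) → M) v]
  let ι := Σ t : Finset M, L.Formula (t ⊕ Fin 1)
  cases nonempty_encodable ι
  -- A task asks for a witness of a formula with parameters `t`. Its premise speaks of isolated sets
  -- above `s` that contain `t`: a premise `t ⊆ s` could hold only at a later stage of the ideal.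
  let 𝒟 : ι → Order.Cofinal P := fun i => ⟨{s | (∃ s' : P, s ≤ s' ∧ i.1 ⊆ s'.1) →
      (∃ c, i.2.Realize (Sum.elim Subtype.val c)) →
      ∃ c, i.2.Realize (Sum.elim Subtype.val c) ∧ c 0 ∈ s.1}, fun s => by
    by_cases hs : ∃ s' : P, s ≤ s' ∧ i.1 ⊆ s'.1
    swap
    · exact ⟨s, fun hs' => (hs hs').elim, le_rfl⟩
    by_cases hc : ∃ c, i.2.Realize (Sum.elim Subtype.val c)
    swap
    · exact ⟨s, fun _ hc' => (hc hc').elim, le_rfl⟩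
    obtain ⟨s', hss', his'⟩ := hs
    obtain ⟨c, hc⟩ := hc
    let k : i.1 ⊕ Fin 1 → s'.1 ⊕ Fin 1 := Sum.map (fun x => ⟨x.1, his' x.2⟩) id
    have hk : ∀ c : Fin 1 → M, Sum.elim (Subtype.val : s'.1 → M) c ∘ k =
        Sum.elim Subtype.val c := fun c => by ext (x | x) <;> rfl
    obtain ⟨d, hd, hiso⟩ := h.exists_isIsolated_sumElim s'.2
      (i.2.relabel k) (c := c) (by rwa [Formula.realize_relabel, hk])
    let f : ↥(insert (d 0) s'.1 : Finset M) → s'.1 ⊕ Fin 1 := fun x =>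
      if hx : x.1 ∈ s'.1 then Sum.inl ⟨x.1, hx⟩ else Sum.inr 0
    refine ⟨⟨insert (d 0) s'.1, ?_⟩, fun _ _ => ⟨d, ?_, Finset.mem_insert_self _ _⟩,
      fun x hx => Finset.mem_insert_of_mem (hss' hx)⟩
    · convert! hiso.comp f using 1
      ext x
      by_cases hx : x.1 ∈ s'.1
      · simp [f, hx]
      · simpa [f, hx] using (Finset.mem_insert.1 x.2).resolve_right hx
    · rwa [Formula.realize_relabel, hk] at hd⟩
  let I : Order.Ideal P := Order.idealOfCofinals ⟨∅, hempty⟩ 𝒟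
  let A : Set M := {a | ∃ s ∈ I, a ∈ s.1}
  have hfin : ∀ t : Finset M, ↑t ⊆ A → ∃ s ∈ I, t ⊆ s.1 := by
    intro t
    induction t using Finset.induction with
    | empty => exact fun _ => ⟨⟨∅, hempty⟩, Order.mem_idealOfCofinals _ _, by simp⟩
    | insert a t _ ih =>
      intro ht
      rw [Finset.coe_insert, Set.insert_subset_iff] at ht
      obtain ⟨s, hs, hts⟩ := ih ht.2
      obtain ⟨s', hs', has⟩ := ht.1
      obtain ⟨r, hr, hsr, hs'r⟩ := I.directed s hs s' hs'
      exact ⟨r, hr, Finset.insert_subset (hs'r has) (hts.trans hsr)⟩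
  have hA : L.MeetsDefinable A := by
    rintro D ⟨a, ha⟩ hD
    obtain ⟨φ, hφ⟩ := Set.definable_iff_exists_formula_sum.1 hD
    have hφ : ∀ c : Fin 1 → M, c 0 ∈ D ↔ φ.Realize (Sum.elim Subtype.val c) := fun c =>
      Set.ext_iff.1 hφ c
    let t : Finset M := φ.freeVarFinset.toLeft.image Subtype.val
    have hf : ∀ x : φ.freeVarFinset, ∃ y : t ⊕ Fin 1, ∀ c : Fin 1 → M,
        (Sum.elim Subtype.val c y : M) = Sum.elim Subtype.val c x.1 := by
      rintro ⟨x | x, hx⟩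
      · exact ⟨Sum.inl ⟨x.1, Finset.mem_image_of_mem _ (Finset.mem_toLeft.2 hx)⟩, fun c => rfl⟩
      · exact ⟨Sum.inr x, fun c => rfl⟩
    choose f hf using hf
    let ψ : L.Formula (t ⊕ Fin 1) := BoundedFormula.restrictFreeVar φ f
    have hψ : ∀ c : Fin 1 → M, ψ.Realize (Sum.elim Subtype.val c) ↔ c 0 ∈ D := fun c => by
      rw [hφ]
      exact BoundedFormula.realize_restrictFreeVar _ fun x => hf x c
    obtain ⟨s, hs𝒟, hs⟩ := Order.cofinal_meets_idealOfCofinals ⟨∅, hempty⟩ 𝒟 ⟨t, ψ⟩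
    obtain ⟨s', hs', ht⟩ := hfin t (by
      intro x hx
      obtain ⟨y, -, rfl⟩ := Finset.mem_image.1 hx
      exact y.2)
    obtain ⟨r, hr, hsr, hs'r⟩ := I.directed s hs s' hs'
    obtain ⟨c, hc, hcs⟩ := hs𝒟 ⟨r, hsr, ht.trans hs'r⟩ ⟨fun _ => a, (hψ _).2 ha⟩
    exact ⟨c 0, (hψ c).1 hc, s, hs, hcs⟩
  let N := hA.toElementarySubstructure
  obtain ⟨e⟩ := h.2 N inferInstance N.elementarilyEquivalent.symm
  let j : M ↪ₑ[L] M := N.subtype.comp e.toElementaryEmbedding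
  have hj : ∀ a, j a ∈ A := fun a => by
    have : (e a : M) ∈ Substructure.closure L A := (e a).2
    rwa [← SetLike.mem_coe, hA.closure_eq_self] at this
  cases nonempty_fintype α
  obtain ⟨s, -, hs⟩ := hfin (Finset.univ.image (j ∘ v)) (by
    intro x hx
    obtain ⟨a, -, rfl⟩ := Finset.mem_image.1 hx
    exact hj _)
  obtain ⟨χ, hχ, hiso⟩ := s.2.comp fun a =>
    ⟨j (v a), hs (Finset.mem_image_of_mem (j ∘ v) (Finset.mem_univ a))⟩
  refine ⟨χ, (j.map_formula χ v).1 hχ, fun w hw φ hφ => (j.map_formula φ w).1 ?_⟩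
  exact hiso _ ((j.map_formula χ w).2 hw) φ ((j.map_formula φ v).2 hφ)

/-- If two tuples satisfy the same formulas, then every extension of one is matched by an
extension of the other. -/
theorem IsOmegaCategorical.exists_extension [Countable L.Symbols] (h : IsOmegaCategorical L M)
    {α : Type u} [Finite α] {v w : α → M} (hvw : ∀ φ : L.Formula α, φ.Realize v ↔ φ.Realize w)
    (a : M) : ∃ b : M, ∀ φ : L.Formula (α ⊕ Fin 1),
      φ.Realize (Sum.elim v fun _ => a) ↔ φ.Realize (Sum.elim w fun _ => b) := by
  have : Nonempty M := ⟨a⟩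
  obtain ⟨χ, hχ, hiso⟩ := h.isIsolated (L := L) (Sum.elim v fun _ : Fin 1 => a)
  have := (hvw (χ.iExs (Fin 1))).1 (Formula.realize_iExs.2 ⟨_, hχ⟩)
  obtain ⟨d, hd⟩ := Formula.realize_iExs.1 this
  refine ⟨d 0, realize_iff_of_forall_realize (hiso _ ?_)⟩
  rwa [show (fun _ => d 0) = d from funext fun i => by rw [Subsingleton.elim i 0] ]

/-- A countable `ω`-categorical structure is homogeneous. -/
theorem IsOmegaCategorical.exists_equiv [Countable L.Symbols] (h : IsOmegaCategorical L M)
    {a b : M} (hab : ∀ φ : L.Formula (Fin 1),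
      φ.Realize (fun _ => a) ↔ φ.Realize (fun _ => b)) :
    ∃ g : M ≃[L] M, g a = b := by
  classical
  have := h.1
  let G : Set (Finset (M × M)) := {s | ∀ φ : L.Formula s,
    φ.Realize (fun p => p.1.1) ↔ φ.Realize (fun p => p.1.2)}
  -- the index of an element of `insert p s` in `s ⊕ Fin 1`
  let f : ∀ (s : Finset (M × M)) (p : M × M), ↥(insert p s : Finset (M × M)) → s ⊕ Fin 1 :=
    fun s p x => if hx : x.1 ∈ s then Sum.inl ⟨x.1, hx⟩ else Sum.inr 0
  have hf : ∀ (s : Finset (M × M)) (p : M × M) (k : M × M → M),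
      (fun x : (insert p s : Finset (M × M)) => k x.1) =
        Sum.elim (fun x : s => k x.1) (fun _ => k p) ∘ f s p := fun s p k => by
    ext x
    by_cases hx : x.1 ∈ s
    · simp [f, hx]
    · have hxp := (Finset.mem_insert.1 x.2).resolve_right hx
      simp [f, hxp, hxp ▸ hx]
  have hG : ∀ (s : Finset (M × M)) (a b : M), (∀ φ : L.Formula (s ⊕ Fin 1),
      φ.Realize (Sum.elim (fun p : s => p.1.1) fun _ => a) ↔
        φ.Realize (Sum.elim (fun p : s => p.1.2) fun _ => b)) → insert (a, b) s ∈ G := by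
    intro s a b hs φ
    rw [hf s (a, b) Prod.fst, hf s (a, b) Prod.snd, ← Formula.realize_relabel,
      ← Formula.realize_relabel]
    exact hs _
  obtain ⟨e, he, hG⟩ := exists_equiv_of_back_and_forth G
    (fun s hs p hp q hq => by
      simpa [Formula.realize_equal] using
        hs ((Term.var ⟨p, hp⟩).equal (Term.var ⟨q, hq⟩)))
    (fun s hs a => by
      obtain ⟨b, hb⟩ := h.exists_extension hs a
      exact ⟨b, _, hG s a b hb, Finset.subset_insert _ _, Finset.mem_insert_self _ _⟩)
    (fun s hs b => by
      obtain ⟨a, ha⟩ := h.exists_extension (fun φ => (hs φ).symm) b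
      exact ⟨a, _, hG s a b fun φ => (ha φ).symm, Finset.subset_insert _ _,
        Finset.mem_insert_self _ _⟩)
    (s₀ := {(a, b)}) (fun φ => by
      have := hab (φ.relabel fun _ => 0)
      rw [Formula.realize_relabel, Formula.realize_relabel] at this
      convert! this using 2
      · ext x
        simp [Finset.mem_singleton.1 x.2]
      · ext x
        simp [Finset.mem_singleton.1 x.2])
  have key : ∀ (n : ℕ) (φ : L.Formula (Fin n)) (x : Fin n → M),
      φ.Realize (e ∘ x) ↔ φ.Realize x := by
    intro n φ x
    obtain ⟨s, hs, hxs⟩ := hG (Finset.univ.image x)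
    have := hs (φ.relabel fun i =>
      ⟨(x i, e (x i)), hxs _ (Finset.mem_image_of_mem _ (Finset.mem_univ i))⟩)
    rw [Formula.realize_relabel, Formula.realize_relabel] at this
    exact this.symm
  refine ⟨⟨e, fun {n} k x => ?_, fun {n} r x => ?_⟩, he (a, b) (Finset.mem_singleton_self _)⟩
  · have := key (n + 1) (Formula.graph k) (Fin.cons (Structure.funMap k x) x)
    rw [show e ∘ (Fin.cons (Structure.funMap k x) x : Fin (n + 1) → M) =
      Fin.cons (e (Structure.funMap k x)) (e ∘ x) from by
        ext i; cases i using Fin.cases <;> rfl, Formula.realize_graph,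
      Formula.realize_graph] at this
    exact (this.2 rfl).symm
  · have := key n (r.formula fun i => Term.var i) x
    simpa [Formula.realize_rel, Function.comp_def] using this

/-- The automorphism group of a countable `ω`-categorical structure has finitely many orbits on
elements: every invariant function takes finitely many values. -/
theorem IsOmegaCategorical.finite_range_of_invariant [Countable L.Symbols]
    (h : IsOmegaCategorical L M) {β : Type*} (f : M → β)
    (hf : ∀ (g : M ≃[L] M) (a : M), f (g a) = f a) : (Set.range f).Finite := by
  classical
  cases isEmpty_or_nonempty M
  · exact Set.finite_range f
  let Φ : Set (L.Formula (Fin 1)) := {φ | ∀ v w : Fin 1 → M, ¬ φ.Realize v → ¬ φ.Realize w →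
    ∀ ψ : L.Formula (Fin 1), ψ.Realize v → ψ.Realize w}
  obtain ⟨Ψ, hΨ, hcover⟩ : ∃ Ψ : Finset (L.Formula (Fin 1)), ↑Ψ ⊆ Φ ∧
      ∀ v : Fin 1 → M, ∃ φ ∈ Ψ, ¬ φ.Realize v := by
    by_contra! hno
    obtain ⟨v, hv⟩ := h.exists_realize_of_finitely_satisfiable Φ hno
    obtain ⟨χ, hχ, hiso⟩ := h.isIsolated (L := L) v
    refine hv χ.not (fun x y hx hy ψ hψ => ?_) hχ
    simp only [Formula.realize_not, not_not] at hx hy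
    exact hiso y hy ψ ((realize_iff_of_forall_realize (hiso x hx) ψ).2 hψ)
  choose φ hφ hrealize using fun a : M => hcover fun _ => a
  have hfac : ∀ a b, φ a = φ b → f a = f b := fun a b hab => by
    obtain ⟨g, rfl⟩ := h.exists_equiv (realize_iff_of_forall_realize
      (hΨ (hφ a) _ _ (hrealize a) (hab ▸ hrealize b)))
    exact (hf g a).symm
  have : Finite (Set.range φ) :=
    (Ψ.finite_toSet.subset (Set.range_subset_iff.2 hφ)).to_subtype
  refine (Set.finite_range fun y : Set.range φ => f y.2.choose).subset ?_
  rintro _ ⟨a, rfl⟩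
  exact ⟨⟨φ a, a, rfl⟩, hfac _ _ (Exists.choose_spec (⟨a, rfl⟩ : φ a ∈ Set.range φ))⟩

end Orbits

/-! ### The Stone space of a Boolean ring -/

namespace NonUnitalBooleanRing

variable {R : Type u} [NonUnitalBooleanRing R]

theorem mul_self (a : R) : a * a = a := isIdempotentElem a

theorem add_self (a : R) : a + a = 0 := by
  have h := mul_self (a + a)
  rw [add_mul, mul_add, mul_self] at h
  simpa using h

theorem neg_eq (a : R) : -a = a := (eq_neg_of_add_eq_zero_left (add_self a)).symm

protected theorem mul_comm (a b : R) : a * b = b * a := by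
  have h := mul_self (a + b)
  rw [add_mul, mul_add, mul_add, mul_self, mul_self] at h
  have h' : a * b + b * a = 0 := by
    rw [show a * b + b * a = a + a * b + (b * a + b) - (a + b) by abel, h, sub_self]
  rw [eq_neg_of_add_eq_zero_left h', neg_eq]

end NonUnitalBooleanRing

namespace StoneSpace

open NonUnitalBooleanRing

variable {R : Type u} [NonUnitalBooleanRing R]

theorem ideal_injective : Function.Injective (ideal : StoneSpace R → TwoSidedIdeal R) := by
  rintro ⟨I, _, _⟩ ⟨J, _, _⟩ rfl
  rfl

theorem mem_basicOpen {a : R} {x : StoneSpace R} : x ∈ basicOpen a ↔ a ∉ x.ideal := Iff.rfl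

@[simp] theorem basicOpen_zero : basicOpen (0 : R) = ∅ :=
  Set.eq_empty_of_forall_notMem fun x hx => hx x.ideal.zero_mem

@[simp] theorem basicOpen_mul (a b : R) : basicOpen (a * b) = basicOpen a ∩ basicOpen b := by
  ext x
  refine ⟨fun h => ⟨fun ha => h (x.ideal.mul_mem_right _ _ ha),
    fun hb => h (x.ideal.mul_mem_left _ _ hb)⟩, fun h hab => ?_⟩
  exact (x.mem_or_mem a b hab).elim h.1 h.2

theorem mem_basicOpen_add {a b : R} {x : StoneSpace R} :
    x ∈ basicOpen (a + b) ↔ ¬ (x ∈ basicOpen a ↔ x ∈ basicOpen b) := by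
  simp only [mem_basicOpen, not_iff_not]
  by_cases ha : a ∈ x.ideal <;> by_cases hb : b ∈ x.ideal
  · simp [ha, hb, x.ideal.add_mem ha hb]
  · simp only [ha, hb, iff_false, not_true]
    exact fun h => hb (by simpa using x.ideal.sub_mem h ha)
  · simp only [ha, hb, iff_true, iff_false]
    exact fun h : a + b ∈ x.ideal => ha (by
      have h' := x.ideal.sub_mem h hb
      rwa [add_sub_cancel_right] at h')
  · simp only [ha, hb, iff_true]
    have h : (a + b) * (a * b) ∈ x.ideal := by
      have : (a + b) * (a * b) = 0 := by
        rw [add_mul, ← mul_assoc, mul_self, NonUnitalBooleanRing.mul_comm a b, ← mul_assoc,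
          mul_self, add_self]
      rw [this]
      exact x.ideal.zero_mem
    refine (x.mem_or_mem _ _ h).resolve_right fun hab => ?_
    exact (x.mem_or_mem _ _ hab).elim ha hb

/-- The ring element of the union of two compact open sets. -/
theorem basicOpen_add_add_mul (a b : R) :
    basicOpen (a + b + a * b) = basicOpen a ∪ basicOpen b := by
  ext x
  rw [mem_basicOpen_add, mem_basicOpen_add, basicOpen_mul, Set.mem_inter_iff, Set.mem_union]
  tauto

/-- The ring element of the difference of two compact open sets. -/
theorem basicOpen_add_mul (a b : R) : basicOpen (a + a * b) = basicOpen a \ basicOpen b := by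
  ext x
  rw [mem_basicOpen_add, basicOpen_mul, Set.mem_inter_iff, Set.mem_sdiff]
  tauto

theorem exists_mem_basicOpen (x : StoneSpace R) : ∃ a : R, x ∈ basicOpen a := by
  by_contra! h
  exact x.ne_top (TwoSidedIdeal.ext fun a => by simpa [mem_basicOpen] using h a)

theorem isOpen_basicOpen (a : R) : IsOpen (basicOpen a) :=
  TopologicalSpace.isOpen_generateFrom_of_mem ⟨a, rfl⟩

theorem isTopologicalBasis_basicOpen :
    TopologicalSpace.IsTopologicalBasis (Set.range (basicOpen (R := R))) where
  exists_subset_inter := by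
    rintro _ ⟨a, rfl⟩ _ ⟨b, rfl⟩ x hx
    exact ⟨_, ⟨a * b, rfl⟩, by simpa using hx, by simp⟩
  sUnion_eq := Set.eq_univ_of_forall fun x =>
    let ⟨a, ha⟩ := exists_mem_basicOpen x
    ⟨_, ⟨a, rfl⟩, ha⟩
  eq_generateFrom := rfl

theorem exists_basicOpen_subset {x : StoneSpace R} {U : Set (StoneSpace R)} (hU : IsOpen U)
    (hx : x ∈ U) : ∃ a : R, x ∈ basicOpen a ∧ basicOpen a ⊆ U := by
  obtain ⟨_, ⟨a, rfl⟩, ha⟩ := isTopologicalBasis_basicOpen.exists_subset_of_mem_open hx hU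
  exact ⟨a, ha⟩

theorem isClosed_basicOpen (a : R) : IsClosed (basicOpen a) := by
  refine isOpen_compl_iff.1 (isOpen_iff_forall_mem_open.2 fun x hx => ?_)
  obtain ⟨b, hb⟩ := exists_mem_basicOpen x
  exact ⟨basicOpen (b + b * a), by simp [basicOpen_add_mul, Set.sdiff_eq], isOpen_basicOpen _, by
    rw [basicOpen_add_mul]; exact ⟨hb, hx⟩⟩

instance : T2Space (StoneSpace R) where
  t2 := by
    intro x y hxy
    suffices ∀ x y : StoneSpace R, (∃ a : R, x ∈ basicOpen a ∧ y ∉ basicOpen a) →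
        ∃ U V, IsOpen U ∧ IsOpen V ∧ x ∈ U ∧ y ∈ V ∧ Disjoint U V by
      by_cases h : ∃ a : R, x ∈ basicOpen a ∧ y ∉ basicOpen a
      · exact this x y h
      by_cases h' : ∃ a : R, y ∈ basicOpen a ∧ x ∉ basicOpen a
      · obtain ⟨U, V, hU, hV, hyU, hxV, hUV⟩ := this y x h'
        exact ⟨V, U, hV, hU, hxV, hyU, hUV.symm⟩
      · push Not at h h'
        exact (hxy (ideal_injective (TwoSidedIdeal.ext fun a =>
          not_iff_not.1 ⟨h a, h' a⟩))).elim
    rintro x y ⟨a, hx, hy⟩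
    exact ⟨basicOpen a, (basicOpen a)ᶜ, isOpen_basicOpen a, (isClosed_basicOpen a).isOpen_compl,
      hx, hy, disjoint_compl_right⟩

/-- Every nonzero character of the ring, with values in the two-element ring, comes from a point. -/
theorem exists_of_character (f : R → Bool) (hadd : ∀ a b, f (a + b) = xor (f a) (f b))
    (hmul : ∀ a b, f (a * b) = (f a && f b)) {a : R} (ha : f a = true) :
    ∃ x : StoneSpace R, ∀ b, x ∈ basicOpen b ↔ f b = true := by
  have h0 : f 0 = false := by simpa using hadd 0 0
  refine ⟨⟨TwoSidedIdeal.mk' {b | f b = false} h0 ?_ ?_ ?_ ?_, ?_, ?_⟩, ?_⟩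
  · intro x y hx hy
    simp_all
  · intro x hx
    simpa [neg_eq] using hx
  · intro x y hy
    simp_all
  · intro x y hx
    simp_all
  · intro h
    have : a ∈ (⊤ : TwoSidedIdeal R) := trivial
    rw [← h, TwoSidedIdeal.mem_mk'] at this
    simp_all
  · intro x y
    simp only [TwoSidedIdeal.mem_mk', Set.mem_ofPred_eq, hmul]
    exact Bool.and_eq_false_iff.1
  · intro b
    simp [mem_basicOpen]

/-- The Stone space embeds into the compact product of copies of the two-point space, and the image
of a basic open set is closed there. -/
theorem isCompact_basicOpen (a : R) : IsCompact (basicOpen a) := by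
  classical
  let e : StoneSpace R → (R → Bool) := fun x b => (basicOpen b).boolIndicator x
  have he : Topology.IsInducing e := by
    refine ⟨le_antisymm ?_ ?_⟩
    · rw [← continuous_iff_le_induced]
      exact continuous_pi fun b => (continuous_boolIndicator_iff_isClopen _).2
        ⟨isClosed_basicOpen b, isOpen_basicOpen b⟩
    · refine le_generateFrom ?_
      rintro _ ⟨b, rfl⟩
      refine ⟨{f | f b = true}, ?_, by ext; simp [e, Set.boolIndicator]⟩
      exact (show Continuous fun f : R → Bool => f b from continuous_apply b).isOpen_preimage _
        (isOpen_discrete {true})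
  rw [he.isCompact_iff]
  have : e '' basicOpen a = {f | f a = true} ∩ ((⋂ (b) (c), {f | f (b + c) = xor (f b) (f c)}) ∩
      ⋂ (b) (c), {f | f (b * c) = (f b && f c)}) := by
    ext f
    simp only [Set.mem_image, Set.mem_inter_iff, Set.mem_iInter, Set.mem_ofPred_eq]
    constructor
    · rintro ⟨x, hx, rfl⟩
      refine ⟨by simpa [e, Set.boolIndicator] using hx, fun b c => ?_, fun b c => ?_⟩
      all_goals by_cases hb : x ∈ basicOpen b <;> by_cases hc : x ∈ basicOpen c <;>
        simp [e, Set.boolIndicator, mem_basicOpen_add, hb, hc]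
    · rintro ⟨ha, hadd, hmul⟩
      obtain ⟨x, hx⟩ := exists_of_character f hadd hmul ha
      exact ⟨x, (hx a).2 ha, funext fun b => by simp [e, Set.boolIndicator, hx]⟩
  rw [this]
  have hc : ∀ (g : Bool → Bool → Bool) (b c : R),
      Continuous fun f : R → Bool => g (f b) (f c) := fun g b c => by
    have h : Continuous fun p : Bool × Bool => g p.1 p.2 := continuous_of_discreteTopology
    exact h.comp (f := fun f : R → Bool => (f b, f c))
      ((continuous_apply b).prodMk (continuous_apply c))
  refine IsClosed.isCompact (((isClosed_eq (continuous_apply a) continuous_const)).inter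
    ((isClosed_iInter fun b => isClosed_iInter fun c => ?_).inter
      (isClosed_iInter fun b => isClosed_iInter fun c => ?_)))
  · exact isClosed_eq (continuous_apply _) (hc xor b c)
  · exact isClosed_eq (continuous_apply _) (hc and b c)

theorem exists_basicOpen_between {K U : Set (StoneSpace R)} (hK : IsCompact K) (hU : IsOpen U)
    (hKU : K ⊆ U) : ∃ a : R, K ⊆ basicOpen a ∧ basicOpen a ⊆ U := by
  refine hK.induction_on (p := fun K => ∃ a : R, K ⊆ basicOpen a ∧ basicOpen a ⊆ U)
    ⟨0, by simp⟩ (fun s t hst ⟨a, ha, haU⟩ => ⟨a, hst.trans ha, haU⟩) ?_ fun x hx => ?_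
  · rintro s t ⟨a, ha, haU⟩ ⟨b, hb, hbU⟩
    refine ⟨a + b + a * b, ?_, ?_⟩ <;> rw [basicOpen_add_add_mul]
    exacts [Set.union_subset_union ha hb, Set.union_subset haU hbU]
  · obtain ⟨a, ha, haU⟩ := exists_basicOpen_subset hU (hKU hx)
    exact ⟨basicOpen a, mem_nhdsWithin_of_mem_nhds ((isOpen_basicOpen a).mem_nhds ha), a,
      subset_rfl, haU⟩

/-- Prime ideals separate: an element that is not in an ideal has a prime ideal above the ideal that
avoids it. -/
theorem exists_mem_basicOpen_of_notMem {I : TwoSidedIdeal R} {a : R} (ha : a ∉ I) :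
    ∃ x ∈ basicOpen a, ∀ b ∈ I, x ∉ basicOpen b := by
  obtain ⟨J, hIJ, hJ⟩ := zorn_le_nonempty₀ {J : TwoSidedIdeal R | a ∉ J} (fun c hc hchain y hy => by
    refine ⟨TwoSidedIdeal.mk' {b | ∃ J ∈ c, b ∈ J} ⟨y, hy, y.zero_mem⟩ ?_ ?_ ?_ ?_, ?_, ?_⟩
    · rintro p q ⟨J, hJ, hp⟩ ⟨J', hJ', hq⟩
      obtain h | h := hchain.total hJ hJ'
      · exact ⟨J', hJ', J'.add_mem (h hp) hq⟩
      · exact ⟨J, hJ, J.add_mem hp (h hq)⟩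
    · rintro p ⟨J, hJ, hp⟩
      exact ⟨J, hJ, J.neg_mem hp⟩
    · rintro p q ⟨J, hJ, hp⟩
      exact ⟨J, hJ, J.mul_mem_left _ _ hp⟩
    · rintro p q ⟨J, hJ, hp⟩
      exact ⟨J, hJ, J.mul_mem_right _ _ hp⟩
    · simp only [Set.mem_ofPred_eq, TwoSidedIdeal.mem_mk', not_exists, not_and]
      exact fun J hJ => hc hJ
    · intro z hz p hp
      rw [TwoSidedIdeal.mem_mk']
      exact ⟨z, hz, hp⟩) I ha
  have haJ : a ∉ J := hJ.prop
  -- If `p * q ∈ J` and `p ∉ J`, then the ideal quotient `J : q` properly extends `J`.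
  have hquot : ∀ p q, p * q ∈ J → p ∉ J → a * q ∈ J := by
    intro p q hpq hp
    by_contra haq
    let Q : TwoSidedIdeal R := TwoSidedIdeal.mk' {r | r * q ∈ J} (by simp [J.zero_mem])
      (fun {x y} hx hy => by
        rw [Set.mem_ofPred_eq, add_mul]; exact J.add_mem hx hy)
      (fun {x} hx => by rwa [neg_eq])
      (fun {x y} hy => by rw [Set.mem_ofPred_eq, mul_assoc]; exact J.mul_mem_left _ _ hy)
      (fun {x y} hx => by
        rw [Set.mem_ofPred_eq, NonUnitalBooleanRing.mul_comm x, mul_assoc]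
        exact J.mul_mem_left _ _ hx)
    have hQ : ∀ r, r ∈ Q ↔ r * q ∈ J := fun r => TwoSidedIdeal.mem_mk' ..
    have hJQ : J ≤ Q := fun r hr => (hQ r).2 (J.mul_mem_right _ _ hr)
    exact hp (hJ.le_of_ge (y := Q) (fun h => haq ((hQ a).1 h)) hJQ ((hQ p).2 hpq))
  have hprime : ∀ p q, p * q ∈ J → p ∈ J ∨ q ∈ J := by
    intro p q hpq
    by_contra! h
    have := hquot p q hpq h.1
    rw [NonUnitalBooleanRing.mul_comm] at this
    exact haJ (mul_self a ▸ hquot q a this h.2)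
  exact ⟨⟨J, fun h => haJ (h ▸ trivial), hprime⟩, haJ, fun b hb hx => hx (hIJ hb)⟩

theorem basicOpen_injective : Function.Injective (basicOpen : R → Set (StoneSpace R)) := by
  intro a b hab
  by_contra hne
  have h0 : a + b ∉ (⊥ : TwoSidedIdeal R) := fun h => hne (by
    rw [TwoSidedIdeal.mem_bot] at h
    rw [eq_neg_of_add_eq_zero_left h, neg_eq])
  obtain ⟨x, hx, -⟩ := exists_mem_basicOpen_of_notMem h0
  rw [mem_basicOpen_add, hab] at hx
  exact hx Iff.rfl

theorem disjoint_basicOpen_closedSet_iff {J : TwoSidedIdeal R} {a : R} :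
    Disjoint (basicOpen a) (closedSet J) ↔ a ∈ J := by
  refine ⟨fun h => by_contra fun ha => ?_, fun ha => ?_⟩
  · obtain ⟨x, hx, hxJ⟩ := exists_mem_basicOpen_of_notMem ha
    exact Set.disjoint_left.1 h hx (by simpa [closedSet] using hxJ)
  · rw [closedSet, Set.disjoint_compl_right_iff_subset]
    exact Set.subset_biUnion_of_mem (u := fun a => basicOpen a) ha

end StoneSpace

/-! ### Finiteness of the generated closure algebra -/

section ClosureAlgebra

variable {X : Type u} [TopologicalSpace X] {n : ℕ}

theorem generatedClosureAlgebra_le {C : Fin n → Set X} {L : BooleanSubalgebra (Set X)}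
    (hC : ∀ i, C i ∈ L) (hL : ∀ A ∈ L, closure A ∈ L) : generatedClosureAlgebra C ≤ L :=
  sInf_le (Set.mem_ofPred_eq ▸ ⟨hC, hL⟩)

/-- A homeomorphism that fixes the generators fixes the whole closure algebra. -/
theorem preimage_eq_of_mem_generatedClosureAlgebra {C : Fin n → Set X} (h : X ≃ₜ X)
    (hC : ∀ i, h ⁻¹' C i = C i) {A : Set X} (hA : A ∈ generatedClosureAlgebra C) :
    h ⁻¹' A = A := by
  let L : BooleanSubalgebra (Set X) :=
    { carrier := {A | h ⁻¹' A = A}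
      supClosed' := fun A hA B hB => by
        simp only [Set.mem_ofPred_eq, Set.sup_eq_union, Set.preimage_union] at *
        rw [hA, hB]
      infClosed' := fun A hA B hB => by
        simp only [Set.mem_ofPred_eq, Set.inf_eq_inter, Set.preimage_inter] at *
        rw [hA, hB]
      compl_mem' := fun {A} hA => by
        simp only [Set.mem_ofPred_eq, Set.preimage_compl] at *
        rw [hA]
      bot_mem' := rfl }
  exact generatedClosureAlgebra_le (L := L) hC (fun A hA =>
    show h ⁻¹' closure A = closure A by rw [h.preimage_closure, show h ⁻¹' A = A from hA]) hA

/-- If only finitely many closed sets are invariant under a set of homeomorphisms that fix the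
closed generators, then the closure algebra is finite: it is contained in the finite algebra of
those sets that are unions of classes of points lying in the same invariant closed sets. -/
theorem finite_generatedClosureAlgebra {C : Fin n → Set X} (H : Set (X ≃ₜ X))
    (hclosed : ∀ i, IsClosed (C i)) (hC : ∀ h ∈ H, ∀ i, h ⁻¹' C i = C i)
    (hfin : {F : Set X | IsClosed F ∧ ∀ h ∈ H, h ⁻¹' F = F}.Finite) :
    Finite (generatedClosureAlgebra C) := by
  -- for `h ∈ H`, the points `z` and `h z` lie in the same members of `𝒦`, so every union of classes
  -- is invariant
  let 𝒦 : Set (Set X) := {F : Set X | IsClosed F ∧ ∀ h ∈ H, h ⁻¹' F = F}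
  -- the sets that are unions of classes
  let L : BooleanSubalgebra (Set X) :=
    { carrier := {A | ∀ x y, (∀ F ∈ 𝒦, x ∈ F ↔ y ∈ F) → (x ∈ A ↔ y ∈ A)}
      supClosed' := fun A hA B hB x y hxy => or_congr (hA x y hxy) (hB x y hxy)
      infClosed' := fun A hA B hB x y hxy => and_congr (hA x y hxy) (hB x y hxy)
      compl_mem' := fun hA x y hxy => not_congr (hA x y hxy)
      bot_mem' := fun x y hxy => Iff.rfl }
  have hle : generatedClosureAlgebra C ≤ L := by
    refine generatedClosureAlgebra_le
      (fun i x y hxy => hxy _ ⟨hclosed i, fun h hh => hC h hh i⟩) fun A hA x y hxy => ?_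
    refine hxy _ ⟨isClosed_closure, fun h hh => ?_⟩
    rw [h.preimage_closure]
    congr 1
    ext z
    refine hA (h z) z fun F hF => ?_
    rw [← Set.mem_preimage, hF.2 h hh]
  have : Finite 𝒦 := hfin
  let f : generatedClosureAlgebra C → Set (Set 𝒦) := fun A =>
    {S | ∃ x ∈ (A : Set X), S = {F | x ∈ F.1}}
  have key : ∀ A B, f A = f B → (A : Set X) ⊆ B := by
    intro A B hAB x hx
    have : {F : 𝒦 | x ∈ F.1} ∈ f B := hAB ▸ ⟨x, hx, rfl⟩
    obtain ⟨y, hy, hxy⟩ := this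
    exact (hle B.2 x y fun F hF => Set.ext_iff.1 hxy ⟨F, hF⟩).2 hy
  exact Finite.of_injective f fun A B hAB =>
    Subtype.ext ((key A B hAB).antisymm (key B A hAB.symm))

end ClosureAlgebra

namespace StoneSpace

variable {R : Type u} [NonUnitalBooleanRing R]

/-- The homeomorphism of the Stone space induced by a ring automorphism. -/
def homeomorphOfRingEquiv (g : R ≃+* R) : StoneSpace R ≃ₜ StoneSpace R where
  toFun x := ⟨x.ideal.comap g, fun h => x.ne_top (TwoSidedIdeal.ext fun a => by
      have : g.symm a ∈ x.ideal.comap g := h ▸ trivial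
      rw [TwoSidedIdeal.mem_comap] at this
      simpa using this),
    fun a b h => by
      simp only [TwoSidedIdeal.mem_comap, map_mul] at h ⊢
      exact x.mem_or_mem _ _ h⟩
  invFun x := ⟨x.ideal.comap g.symm, fun h => x.ne_top (TwoSidedIdeal.ext fun a => by
      have : g a ∈ x.ideal.comap g.symm := h ▸ trivial
      rw [TwoSidedIdeal.mem_comap] at this
      simpa using this),
    fun a b h => by
      simp only [TwoSidedIdeal.mem_comap, map_mul] at h ⊢
      exact x.mem_or_mem _ _ h⟩
  left_inv x := ideal_injective (TwoSidedIdeal.ext fun a => by simp [TwoSidedIdeal.mem_comap])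
  right_inv x := ideal_injective (TwoSidedIdeal.ext fun a => by simp [TwoSidedIdeal.mem_comap])
  continuous_toFun := continuous_generateFrom_iff.2 (by
    rintro _ ⟨a, rfl⟩
    convert isOpen_basicOpen (g a) using 1
    ext x
    simp [mem_basicOpen, TwoSidedIdeal.mem_comap])
  continuous_invFun := continuous_generateFrom_iff.2 (by
    rintro _ ⟨a, rfl⟩
    convert isOpen_basicOpen (g.symm a) using 1
    ext x
    simp [mem_basicOpen, TwoSidedIdeal.mem_comap])

theorem preimage_homeomorphOfRingEquiv_basicOpen (g : R ≃+* R) (a : R) :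
    homeomorphOfRingEquiv g ⁻¹' basicOpen a = basicOpen (g a) := by
  ext x
  simp [mem_basicOpen, homeomorphOfRingEquiv, TwoSidedIdeal.mem_comap]

theorem preimage_homeomorphOfRingEquiv_closedSet (g : R ≃+* R) {J : TwoSidedIdeal R}
    (hg : ∀ a, g a ∈ J ↔ a ∈ J) :
    homeomorphOfRingEquiv g ⁻¹' closedSet J = closedSet J := by
  simp only [closedSet, Set.preimage_compl, Set.preimage_iUnion,
    preimage_homeomorphOfRingEquiv_basicOpen]
  congr 1
  ext x
  simp only [Set.mem_iUnion]
  constructor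
  · rintro ⟨a, ha, hx⟩
    exact ⟨g a, (hg a).2 ha, hx⟩
  · rintro ⟨a, ha, hx⟩
    exact ⟨g.symm a, (hg _).1 (by simpa using ha), by simpa using hx⟩

theorem isClosed_closedSet (J : TwoSidedIdeal R) : IsClosed (closedSet J) :=
  (isOpen_biUnion fun a _ => isOpen_basicOpen a).isClosed_compl

end StoneSpace

/-! ### Consequences of categoricity for a Boolean ring system -/

instance (n : ℕ) : Countable (systemLanguage n).Symbols := by
  have h₁ : Countable (Σ k, (systemLanguage n).Functions k) := by
    let f : Fin 3 → Σ k, BoolRingFunc k := ![⟨0, .zero⟩, ⟨2, .add⟩, ⟨2, .mul⟩]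
    refine Function.Surjective.countable (f := f) ?_
    rintro ⟨_, _ | _ | _⟩
    exacts [⟨0, rfl⟩, ⟨1, rfl⟩, ⟨2, rfl⟩]
  have h₂ : Countable (Σ k, (systemLanguage n).Relations k) := by
    let f : Fin n → Σ k, IdealPred n k := fun i => ⟨1, .mem i⟩
    refine Function.Surjective.countable (f := f) ?_
    rintro ⟨_, ⟨i⟩⟩
    exact ⟨i, rfl⟩
  exact inferInstanceAs (Countable ((Σ k, (systemLanguage n).Functions k) ⊕
    Σ k, (systemLanguage n).Relations k))

namespace IsOmegaCategoricalSystem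

open StoneSpace

variable {R : Type u} [NonUnitalBooleanRing R] {n : ℕ} {J : Fin n → TwoSidedIdeal R}

theorem finite_range_of_invariant (hJ : IsOmegaCategoricalSystem J) {β : Type*} (f : R → β)
    (hf : ∀ g : R ≃+* R, (∀ i a, g a ∈ J i ↔ a ∈ J i) → ∀ a, f (g a) = f a) :
    (Set.range f).Finite := by
  let : (systemLanguage n).Structure R := systemStructure J
  refine IsOmegaCategorical.finite_range_of_invariant (L := systemLanguage n) (M := R) hJ f
    fun g a => ?_
  let g' : R ≃+* R :=
    { g.toEquiv with
      map_add' := fun a b => g.map_fun' (.add : BoolRingFunc 2) ![a, b]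
      map_mul' := fun a b => g.map_fun' (.mul : BoolRingFunc 2) ![a, b] }
  exact hf g' (fun i a => g.map_rel' (.mem i : IdealPred n 1) ![a]) a

/-- The closed sets that are invariant under all automorphisms of an `ω`-categorical system are
finite in number: such a set is determined by an invariant ideal. -/
theorem finite_invariant_closed (hJ : IsOmegaCategoricalSystem J) :
    {F : Set (StoneSpace R) | IsClosed F ∧ ∀ g : R ≃+* R, (∀ i a, g a ∈ J i ↔ a ∈ J i) →
      homeomorphOfRingEquiv g ⁻¹' F = F}.Finite := by
  set 𝒦 := {F : Set (StoneSpace R) | IsClosed F ∧ ∀ g : R ≃+* R, (∀ i a, g a ∈ J i ↔ a ∈ J i) →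
      homeomorphOfRingEquiv g ⁻¹' F = F}
  let f : R → Set 𝒦 := fun a => {F | Disjoint (basicOpen a) F.1}
  have hf : (Set.range f).Finite := hJ.finite_range_of_invariant f fun g hg a => by
    ext F
    simp only [f, Set.mem_ofPred_eq]
    rw [← preimage_homeomorphOfRingEquiv_basicOpen, ← F.2.2 g hg, Set.disjoint_preimage_iff
      (homeomorphOfRingEquiv g).surjective, F.2.2 g hg]
  have := hf.to_subtype
  have hinj : Function.Injective fun F : 𝒦 => {S : Set.range f | F ∈ S.1} := by
    intro F F' hFF'
    have key : ∀ a, Disjoint (basicOpen a) F.1 ↔ Disjoint (basicOpen a) F'.1 := fun a =>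
      Set.ext_iff.1 hFF' ⟨f a, a, rfl⟩
    have hsub : ∀ {A B : Set (StoneSpace R)}, IsClosed B →
        (∀ a, Disjoint (basicOpen a) B → Disjoint (basicOpen a) A) → A ⊆ B := by
      intro A B hB hAB x hx
      by_contra hxB
      obtain ⟨a, hxa, ha⟩ := exists_basicOpen_subset hB.isOpen_compl hxB
      exact Set.disjoint_left.1 (hAB a (Set.subset_compl_iff_disjoint_right.1 ha)) hxa hx
    exact Subtype.ext ((hsub F'.2.1 fun a => (key a).2).antisymm (hsub F.2.1 fun a => (key a).1))
  exact Finite.of_injective _ hinj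

theorem finite_generatedClosureAlgebra (hJ : IsOmegaCategoricalSystem J) :
    Finite (generatedClosureAlgebra fun i => closedSet (J i)) := by
  refine _root_.finite_generatedClosureAlgebra
    {h | ∃ g : R ≃+* R, (∀ i a, g a ∈ J i ↔ a ∈ J i) ∧ homeomorphOfRingEquiv g = h}
    (fun i => isClosed_closedSet _) ?_ (hJ.finite_invariant_closed.subset ?_)
  · rintro _ ⟨g, hg, rfl⟩ i
    exact preimage_homeomorphOfRingEquiv_closedSet g (hg i)
  · exact fun F hF => ⟨hF.1, fun g hg => hF.2 _ ⟨g, hg, rfl⟩⟩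

/-- If a set in the closure algebra had infinitely many isolated points, then compact open sets
would meet it in any finite number of points, and this number is invariant. -/
theorem finite_isolatedPoints (hJ : IsOmegaCategoricalSystem J) {D : Set (StoneSpace R)}
    (hD : D ∈ generatedClosureAlgebra fun i => closedSet (J i)) : (isolatedPoints D).Finite := by
  classical
  by_contra hinf
  have hrange := hJ.finite_range_of_invariant (fun a => (basicOpen a ∩ D).ncard) fun g hg a => by
    have hgD := preimage_eq_of_mem_generatedClosureAlgebra (homeomorphOfRingEquiv g)
      (fun i => preimage_homeomorphOfRingEquiv_closedSet g (hg i)) hD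
    rw [← preimage_homeomorphOfRingEquiv_basicOpen, ← hgD, ← Set.preimage_inter,
      Set.ncard_preimage_of_injective_subset_range (homeomorphOfRingEquiv g).injective
        (by simp [(homeomorphOfRingEquiv g).surjective.range_eq]), hgD]
  have hisol : ∀ x ∈ isolatedPoints D, ∃ a : R, basicOpen a ∩ D = {x} := by
    rintro x ⟨hxD, hx⟩
    rw [mem_derivedSet, accPt_iff_nhds] at hx
    push Not at hx
    obtain ⟨U, hU, hUx⟩ := hx
    obtain ⟨V, hVU, hV, hxV⟩ := mem_nhds_iff.1 hU
    obtain ⟨a, hxa, ha⟩ := exists_basicOpen_subset hV hxV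
    refine ⟨a, Set.eq_singleton_iff_unique_mem.2 ⟨⟨hxa, hxD⟩, fun y hy => ?_⟩⟩
    exact hUx y ⟨hVU (ha hy.1), hy.2⟩
  have hfinset : ∀ t : Finset (StoneSpace R), ↑t ⊆ isolatedPoints D →
      ∃ a : R, basicOpen a ∩ D = t := by
    intro t
    induction t using Finset.induction with
    | empty => exact fun _ => ⟨0, by simp⟩
    | insert x t _ ih =>
      intro ht
      rw [Finset.coe_insert, Set.insert_subset_iff] at ht
      obtain ⟨a, ha⟩ := hisol x ht.1
      obtain ⟨b, hb⟩ := ih ht.2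
      refine ⟨a + b + a * b, ?_⟩
      rw [basicOpen_add_add_mul, Set.union_inter_distrib_right, ha, hb, Finset.coe_insert,
        Set.singleton_union]
  refine Set.infinite_univ (hrange.subset fun m _ => ?_)
  obtain ⟨t, ht, rfl⟩ := Set.Infinite.exists_subset_card_eq hinf m
  obtain ⟨a, ha⟩ := hfinset t ht
  exact ⟨a, by simp only [ha, Set.ncard_coe_finset]⟩

end IsOmegaCategoricalSystem

/-! ### Stratified spaces and matching clopen sets -/

section DerivedSet

variable {X : Type u} [TopologicalSpace X] [T1Space X]

theorem infinite_inter_of_mem_derivedSet {D U : Set X} (hU : IsOpen U) {x : X} (hxU : x ∈ U)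
    (hx : x ∈ derivedSet D) : (U ∩ D).Infinite := by
  intro hfin
  have hV : U \ ((U ∩ D) \ {x}) ∈ nhds x :=
    (hU.sdiff (hfin.subset Set.sdiff_subset).isClosed).mem_nhds ⟨hxU, fun h => h.2 rfl⟩
  obtain ⟨y, ⟨⟨hyU, hy⟩, hyD⟩, hyx⟩ := accPt_iff_nhds.1 hx _ hV
  exact hy ⟨⟨hyU, hyD⟩, hyx⟩

theorem infinite_inter_inter_derivedSet {D U : Set X} (hU : IsOpen U)
    (hD : (isolatedPoints D).Finite) (h : (U ∩ derivedSet D).Nonempty) :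
    (U ∩ D ∩ derivedSet D).Infinite := by
  obtain ⟨x, hxU, hx⟩ := h
  refine ((infinite_inter_of_mem_derivedSet hU hxU hx).sdiff hD).mono ?_
  rintro y ⟨hy, hyD⟩
  exact ⟨hy, by_contra fun h => hyD ⟨hy.2, h⟩⟩

theorem finite_iff_derivedSet_eq_empty {D : Set X} (hD : (isolatedPoints D).Finite) :
    D.Finite ↔ derivedSet D = ∅ := by
  refine ⟨fun h => Set.eq_empty_of_forall_notMem fun x hx => ?_, fun h => ?_⟩
  · exact infinite_inter_of_mem_derivedSet isOpen_univ trivial hx (by simpa using h)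
  · simpa [isolatedPoints, h] using hD

end DerivedSet

/-- A partition of a space into sets with finitely many isolated points, such that the
closure of each stratum is a union of strata. -/
structure IsStratification {X : Type u} [TopologicalSpace X] {ι : Type w} (D : ι → Set X) :
    Prop where
  exists_mem : ∀ x, ∃ i, x ∈ D i
  eq_of_mem : ∀ {i j x}, x ∈ D i → x ∈ D j → i = j
  subset_closure_of_mem : ∀ {i j x}, x ∈ D j → x ∈ closure (D i) → D j ⊆ closure (D i)
  finite_isolatedPoints : ∀ i, (isolatedPoints (D i)).Finite

/-- Two stratifications with the same index set, the same closure relation, the same numbers of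
isolated points, and the same finite and bounded strata. -/
structure StratificationMatch {X : Type u} {Y : Type v} [TopologicalSpace X] [TopologicalSpace Y]
    {ι : Type w} (D : ι → Set X) (E : ι → Set Y) : Prop where
  left : IsStratification D
  right : IsStratification E
  subset_closure_iff : ∀ i j, D j ⊆ closure (D i) ↔ E j ⊆ closure (E i)
  ncard_eq : ∀ i, (isolatedPoints (D i)).ncard = (isolatedPoints (E i)).ncard
  finite_iff : ∀ i, (D i).Finite ↔ (E i).Finite
  isCompact_iff : ∀ i, IsCompact (closure (D i)) ↔ IsCompact (closure (E i))

/-- Two sets are similar if they contain the same number of isolated points of corresponding strata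
and if they contain accumulation points of the same strata. -/
def IsSimilar {X : Type u} {Y : Type v} [TopologicalSpace X] [TopologicalSpace Y]
    {ι : Type w} (D : ι → Set X) (E : ι → Set Y) (A : Set X) (B : Set Y) : Prop :=
  ∀ i, (A ∩ isolatedPoints (D i)).ncard = (B ∩ isolatedPoints (E i)).ncard ∧
    ((A ∩ derivedSet (D i)).Nonempty ↔ (B ∩ derivedSet (E i)).Nonempty)

section Match

variable {X : Type u} {Y : Type v} [TopologicalSpace X] [TopologicalSpace Y] {ι : Type w}
  {D : ι → Set X} {E : ι → Set Y} {A P : Set X} {B : Set Y}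

theorem StratificationMatch.symm (h : StratificationMatch D E) : StratificationMatch E D where
  left := h.right
  right := h.left
  subset_closure_iff i j := (h.subset_closure_iff i j).symm
  ncard_eq i := (h.ncard_eq i).symm
  finite_iff i := (h.finite_iff i).symm
  isCompact_iff i := (h.isCompact_iff i).symm

theorem IsSimilar.symm (h : IsSimilar D E A B) : IsSimilar E D B A :=
  fun i => ⟨(h i).1.symm, (h i).2.symm⟩

theorem StratificationMatch.isSimilar_univ [T1Space X] [T1Space Y]
    (h : StratificationMatch D E) : IsSimilar D E Set.univ Set.univ := fun i => by
  refine ⟨by simpa using h.ncard_eq i, ?_⟩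
  have := h.finite_iff i
  rw [finite_iff_derivedSet_eq_empty (h.left.finite_isolatedPoints i),
    finite_iff_derivedSet_eq_empty (h.right.finite_isolatedPoints i)] at this
  simpa [Set.nonempty_iff_ne_empty] using not_congr this

theorem IsStratification.inter_nonempty_iff [T1Space X] (h : IsStratification D)
    (hA : IsOpen A) (i : ι) : (A ∩ D i).Nonempty ↔
      (A ∩ isolatedPoints (D i)).ncard ≠ 0 ∨ (A ∩ derivedSet (D i)).Nonempty := by
  rw [Ne, Set.ncard_eq_zero ((h.finite_isolatedPoints i).inter_of_right _), ← Ne,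
    ← Set.nonempty_iff_ne_empty]
  constructor
  · rintro ⟨x, hxA, hx⟩
    by_cases hx' : x ∈ derivedSet (D i)
    exacts [Or.inr ⟨x, hxA, hx'⟩, Or.inl ⟨x, hxA, hx, hx'⟩]
  · rintro (⟨x, hxA, hx⟩ | hne)
    · exact ⟨x, hxA, hx.1⟩
    · exact (infinite_inter_inter_derivedSet hA (h.finite_isolatedPoints i) hne).nonempty.mono
        fun x hx => hx.1

theorem IsSimilar.inter_nonempty_iff [T1Space X] [T1Space Y] (hAB : IsSimilar D E A B)
    (h : StratificationMatch D E) (hA : IsOpen A) (hB : IsOpen B) (i : ι) :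
    (A ∩ D i).Nonempty ↔ (B ∩ E i).Nonempty := by
  rw [h.left.inter_nonempty_iff hA, h.right.inter_nonempty_iff hB, (hAB i).1, (hAB i).2]

/-- If an open set `Q` has no accumulation points of the stratum `D i`, then it has none of any
stratum `D j` for which `E j` meets the derived set of `E i`. -/
theorem StratificationMatch.inter_eq_empty (h : StratificationMatch D E) {Q : Set X}
    (hQ : IsOpen Q) {i j : ι} (hi : Q ∩ derivedSet (D i) = ∅) {y : Y} (hy : y ∈ E j)
    (hy' : y ∈ derivedSet (E i)) :
    Q ∩ derivedSet (D j) = ∅ ∧ (y ∈ isolatedPoints (E j) → Q ∩ D j = ∅) := by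
  obtain rfl | hij := eq_or_ne i j
  · exact ⟨hi, fun hiso => (hiso.2 hy').elim⟩
  have hsub := (h.subset_closure_iff i j).2
    (h.right.subset_closure_of_mem hy (derivedSet_subset_closure _ hy'))
  have hQj : Q ∩ D j = ∅ := by
    refine Set.subset_empty_iff.1 fun x hx => ?_
    have hx' : x ∈ closure (D i) := hsub hx.2
    rw [closure_eq_self_union_derivedSet] at hx'
    exact hx'.elim (fun hxi => hij (h.left.eq_of_mem hxi hx.2)) fun hxi => hi.subset ⟨hx.1, hxi⟩
  refine ⟨Set.subset_empty_iff.1 fun x hx => ?_, fun _ => hQj⟩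
  obtain ⟨z, hz⟩ := mem_closure_iff.1 (derivedSet_subset_closure _ hx.2) Q hQ hx.1
  exact (Set.eq_empty_iff_forall_notMem.1 hQj) z hz

/-- Inside one stratum, points of `B` can be distributed in the same way as those of `A` are
distributed over `P` and `A \ P`. -/
theorem IsSimilar.exists_distribution [T1Space X] [T1Space Y] (h : StratificationMatch D E)
    (hAB : IsSimilar D E A B) (hB : IsOpen B) (hPA : P ⊆ A) (i : ι) :
    ∃ F G : Set Y, F.Finite ∧ G.Finite ∧ F ⊆ B ∩ E i ∧ G ⊆ B ∩ E i ∧ Disjoint F G ∧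
      B ∩ isolatedPoints (E i) ⊆ F ∪ G ∧
      (F ∩ isolatedPoints (E i)).ncard = (P ∩ isolatedPoints (D i)).ncard ∧
      (G ∩ isolatedPoints (E i)).ncard = ((A \ P) ∩ isolatedPoints (D i)).ncard ∧
      ((F ∩ derivedSet (E i)).Nonempty ↔ (P ∩ derivedSet (D i)).Nonempty) ∧
      ((G ∩ derivedSet (E i)).Nonempty ↔ ((A \ P) ∩ derivedSet (D i)).Nonempty) := by
  have hDfin : (A ∩ isolatedPoints (D i)).Finite :=
    (h.left.finite_isolatedPoints i).inter_of_right _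
  have hEfin : (B ∩ isolatedPoints (E i)).Finite :=
    (h.right.finite_isolatedPoints i).inter_of_right _
  have hPsub : P ∩ isolatedPoints (D i) ⊆ A ∩ isolatedPoints (D i) :=
    Set.inter_subset_inter_left _ hPA
  obtain ⟨F₀, hF₀, hF₀card⟩ := Set.exists_subset_card_eq
    (s := B ∩ isolatedPoints (E i)) (n := (P ∩ isolatedPoints (D i)).ncard)
    ((Set.ncard_le_ncard hPsub hDfin).trans (hAB i).1.le)
  -- two accumulation points, one for each side
  obtain ⟨p, q, hp, hq, hpq, hpne, hqne⟩ : ∃ p q : Set Y, p.Finite ∧ q.Finite ∧ Disjoint p q ∧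
      (p ⊆ B ∩ E i ∩ derivedSet (E i) ∧
        (p.Nonempty ↔ (P ∩ derivedSet (D i)).Nonempty)) ∧
      (q ⊆ B ∩ E i ∩ derivedSet (E i) ∧
        (q.Nonempty ↔ ((A \ P) ∩ derivedSet (D i)).Nonempty)) := by
    classical
    by_cases hne : (B ∩ derivedSet (E i)).Nonempty
    · obtain ⟨p, hp, q, hq, hpq⟩ := (infinite_inter_inter_derivedSet hB
        (h.right.finite_isolatedPoints i) hne).nontrivial
      refine ⟨{y | y = p ∧ (P ∩ derivedSet (D i)).Nonempty},
        {y | y = q ∧ ((A \ P) ∩ derivedSet (D i)).Nonempty},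
        (Set.finite_singleton p).subset fun y hy => hy.1,
        (Set.finite_singleton q).subset fun y hy => hy.1,
        Set.disjoint_left.2 fun y hy hy' => hpq (hy.1.symm.trans hy'.1),
        ⟨fun y hy => hy.1 ▸ hp, ?_⟩, ⟨fun y hy => hy.1 ▸ hq, ?_⟩⟩
      · exact ⟨fun ⟨y, hy⟩ => hy.2, fun hy => ⟨p, rfl, hy⟩⟩
      · exact ⟨fun ⟨y, hy⟩ => hy.2, fun hy => ⟨q, rfl, hy⟩⟩
    · have hA : ¬ (A ∩ derivedSet (D i)).Nonempty := fun hA => hne ((hAB i).2.1 hA)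
      refine ⟨∅, ∅, Set.finite_empty, Set.finite_empty, disjoint_bot_left,
        ⟨Set.empty_subset _, ?_⟩, ⟨Set.empty_subset _, ?_⟩⟩
      · simpa using fun hne' => hA (hne'.mono (Set.inter_subset_inter_left _ hPA))
      · simpa using fun hne' => hA (hne'.mono (Set.inter_subset_inter_left _ Set.sdiff_subset))
  have hiso : ∀ y ∈ B ∩ E i ∩ derivedSet (E i), y ∉ isolatedPoints (E i) :=
    fun y hy hy' => hy'.2 hy.2
  have hF : (F₀ ∪ p) ∩ isolatedPoints (E i) = F₀ := by
    ext y
    exact ⟨fun hy => hy.1.resolve_right fun hyp => hiso y (hpne.1 hyp) hy.2,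
      fun hy => ⟨Or.inl hy, (hF₀ hy).2⟩⟩
  have hG : (((B ∩ isolatedPoints (E i)) \ F₀) ∪ q) ∩ isolatedPoints (E i) =
      (B ∩ isolatedPoints (E i)) \ F₀ := by
    ext y
    exact ⟨fun hy => hy.1.resolve_right fun hyq => hiso y (hqne.1 hyq) hy.2,
      fun hy => ⟨Or.inl hy, hy.1.2⟩⟩
  refine ⟨F₀ ∪ p, ((B ∩ isolatedPoints (E i)) \ F₀) ∪ q, (hEfin.subset hF₀).union hp,
    (hEfin.subset Set.sdiff_subset).union hq, ?_, ?_, ?_, ?_, ?_, ?_, ?_, ?_⟩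
  · exact Set.union_subset (fun y hy => ⟨(hF₀ hy).1, (hF₀ hy).2.1⟩) fun y hy => (hpne.1 hy).1
  · exact Set.union_subset (fun y hy => ⟨hy.1.1, hy.1.2.1⟩) fun y hy => (hqne.1 hy).1
  · rw [Set.disjoint_left]
    rintro y (hy | hy) (hy' | hy')
    · exact hy'.2 hy
    · exact hiso y (hqne.1 hy') (hF₀ hy).2
    · exact hiso y (hpne.1 hy) hy'.1.2
    · exact Set.disjoint_left.1 hpq hy hy'
  · intro y hy
    by_cases hyF : y ∈ F₀
    exacts [Or.inl (Or.inl hyF), Or.inr (Or.inl ⟨hy, hyF⟩)]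
  · rw [hF, hF₀card]
  · have : (A \ P) ∩ isolatedPoints (D i) =
        (A ∩ isolatedPoints (D i)) \ (P ∩ isolatedPoints (D i)) := by
      ext x
      simp only [Set.mem_inter_iff, Set.mem_sdiff]
      tauto
    rw [hG, this, Set.ncard_sdiff hF₀ (hEfin.subset hF₀), Set.ncard_sdiff hPsub
      (hDfin.subset hPsub), hF₀card, (hAB i).1]
  · rw [← hpne.2]
    refine ⟨?_, fun ⟨y, hy⟩ => ⟨y, Or.inr hy, (hpne.1 hy).2⟩⟩
    rintro ⟨y, hy | hy, hy'⟩
    exacts [((hF₀ hy).2.2 hy').elim, ⟨y, hy⟩]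
  · rw [← hqne.2]
    refine ⟨?_, fun ⟨y, hy⟩ => ⟨y, Or.inr hy, (hqne.1 hy).2⟩⟩
    rintro ⟨y, hy | hy, hy'⟩
    exacts [(hy.1.2.2 hy').elim, ⟨y, hy⟩]

/-- If `A` is similar to the clopen set `B`, then a partition `A = P ∪ (A \ P)` into open sets can
be copied to `B`: all sets between a certain compact set and a certain open set will do. The compact
set contains the points allotted to `P` and all accumulation points of the strata that do not
accumulate in `A \ P`; the complement of the open set is formed in the same way with `P` and `A \ P`
exchanged. -/
theorem IsSimilar.exists_split [Finite ι] [T1Space X] [T1Space Y]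
    (h : StratificationMatch D E) (hAB : IsSimilar D E A B) (hB : IsOpen B) (hPA : P ⊆ A)
    (hP : IsOpen P) (hQ : IsOpen (A \ P))
    (hcpt : ∀ i, (A \ P) ∩ derivedSet (D i) = ∅ → IsCompact (B ∩ derivedSet (E i))) :
    ∃ K U : Set Y, IsCompact K ∧ IsOpen U ∧ K ⊆ U ∧ U ⊆ B ∧
      ∀ V, K ⊆ V → V ⊆ U → IsSimilar D E P V ∧ IsSimilar D E (A \ P) (B \ V) := by
  choose F G hF hG hFB hGB hFG hiso hFcard hGcard hFne hGne using
    hAB.exists_distribution h hB hPA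
  let K : Set Y := (⋃ i, F i) ∪
    ⋃ i : {i // (A \ P) ∩ derivedSet (D i) = ∅}, B ∩ derivedSet (E i)
  let Z : Set Y := (⋃ i, G i) ∪ ⋃ i : {i // P ∩ derivedSet (D i) = ∅}, derivedSet (E i)
  -- points allotted to an open part avoid the derived sets of strata not accumulating there
  have havoid : ∀ {O : Set X} {F : ι → Set Y}, IsOpen O → (∀ i, F i ⊆ B ∩ E i) →
      (∀ i, (F i ∩ isolatedPoints (E i)).ncard = (O ∩ isolatedPoints (D i)).ncard) →
      (∀ i, (F i).Finite) →
      (∀ i, (F i ∩ derivedSet (E i)).Nonempty ↔ (O ∩ derivedSet (D i)).Nonempty) →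
      ∀ {i j : ι} {y : Y}, y ∈ F j → y ∈ derivedSet (E i) → O ∩ derivedSet (D i) = ∅ → False := by
    intro O F hO hFB hcard hfin hne i j y hy hyi hi
    obtain ⟨h₁, h₂⟩ := h.inter_eq_empty hO hi (hFB j hy).2 hyi
    by_cases hyj : y ∈ derivedSet (E j)
    · exact ((hne j).1 ⟨y, hy, hyj⟩).ne_empty h₁
    · have hy' : y ∈ isolatedPoints (E j) := ⟨(hFB j hy).2, hyj⟩
      have h0 : O ∩ isolatedPoints (D j) = ∅ :=
        Set.subset_empty_iff.1 ((Set.inter_subset_inter_right _ Set.sdiff_subset).trans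
          (h₂ hy').subset)
      have := hcard j
      rw [h0, Set.ncard_empty, Set.ncard_eq_zero ((hfin j).inter_of_left _)] at this
      exact this.subset ⟨hy, hy'⟩
  refine ⟨K, B \ Z, ?_, ?_, ?_, Set.sdiff_subset, ?_⟩
  · exact (isCompact_iUnion fun i => (hF i).isCompact).union
      (isCompact_iUnion fun i => hcpt i.1 i.2)
  · exact hB.sdiff ((isClosed_iUnion_of_finite fun i => (hG i).isClosed).union
      (isClosed_iUnion_of_finite fun i => isClosed_derivedSet _))
  · rintro y (hy | hy)
    · obtain ⟨j, hj⟩ := Set.mem_iUnion.1 hy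
      refine ⟨(hFB j hj).1, ?_⟩
      rintro (hy' | hy')
      · obtain ⟨k, hk⟩ := Set.mem_iUnion.1 hy'
        obtain rfl := h.right.eq_of_mem (hFB j hj).2 (hGB k hk).2
        exact Set.disjoint_left.1 (hFG j) hj hk
      · obtain ⟨⟨i, hi⟩, hyi⟩ := Set.mem_iUnion.1 hy'
        exact havoid hP hFB hFcard hF hFne hj hyi hi
    · obtain ⟨⟨i, hi⟩, hyB, hyi⟩ := Set.mem_iUnion.1 hy
      refine ⟨hyB, ?_⟩
      rintro (hy' | hy')
      · obtain ⟨k, hk⟩ := Set.mem_iUnion.1 hy'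
        exact havoid hQ hGB hGcard hG hGne hk hyi hi
      · obtain ⟨⟨k, hk⟩, hyk⟩ := Set.mem_iUnion.1 hy'
        obtain ⟨j, hj⟩ := h.right.exists_mem y
        obtain ⟨hQ₁, hQ₂⟩ := h.inter_eq_empty hQ hi hj hyi
        obtain ⟨hP₁, hP₂⟩ := h.inter_eq_empty hP hk hj hyk
        have hA : ∀ S : Set X, P ∩ S = ∅ → (A \ P) ∩ S = ∅ → A ∩ S = ∅ := fun S hPS hQS => by
          rw [← Set.union_sdiff_cancel hPA, Set.union_inter_distrib_right, hPS, hQS,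
            Set.union_empty]
        by_cases hyj : y ∈ derivedSet (E j)
        · exact ((hAB j).2.2 ⟨y, hyB, hyj⟩).ne_empty (hA _ hP₁ hQ₁)
        · have hy' : y ∈ isolatedPoints (E j) := ⟨hj, hyj⟩
          have h0 : A ∩ isolatedPoints (D j) = ∅ :=
            Set.subset_empty_iff.1 ((Set.inter_subset_inter_right _ Set.sdiff_subset).trans
              (hA _ (hP₂ hy') (hQ₂ hy')).subset)
          have := (hAB j).1
          rw [h0, Set.ncard_empty, eq_comm, Set.ncard_eq_zero
            ((h.right.finite_isolatedPoints j).inter_of_right _)] at this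
          exact this.subset ⟨hyB, hy'⟩
  · intro V hKV hVU
    have hFV : ∀ i, F i ⊆ V := fun i y hy => hKV (Or.inl (Set.mem_iUnion.2 ⟨i, hy⟩))
    have hGV : ∀ i, ∀ y ∈ G i, y ∉ V := fun i y hy hyV =>
      (hVU hyV).2 (Or.inl (Set.mem_iUnion.2 ⟨i, hy⟩))
    refine ⟨fun i => ⟨?_, ?_⟩, fun i => ⟨?_, ?_⟩⟩
    · rw [← hFcard i]
      congr 1
      ext y
      refine ⟨fun hy => ⟨hFV i hy.1, hy.2⟩, fun hy => ⟨?_, hy.2⟩⟩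
      exact (hiso i ⟨(hVU hy.1).1, hy.2⟩).resolve_right fun hyG => hGV i y hyG hy.1
    · refine ⟨fun hne => ((hFne i).2 hne).mono (Set.inter_subset_inter_left _ (hFV i)), ?_⟩
      rintro ⟨y, hyV, hy⟩
      by_contra hne
      exact (hVU hyV).2 (Or.inr (Set.mem_iUnion.2 ⟨⟨i, Set.not_nonempty_iff_eq_empty.1 hne⟩, hy⟩))
    · rw [← hGcard i]
      congr 1
      ext y
      refine ⟨fun hy => ⟨⟨(hGB i hy.1).1, hGV i y hy.1⟩, hy.2⟩, fun hy => ⟨?_, hy.2⟩⟩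
      exact (hiso i ⟨hy.1.1, hy.2⟩).resolve_left fun hyF => hy.1.2 (hFV i hyF)
    · refine ⟨fun hne => ((hGne i).2 hne).mono
        (Set.inter_subset_inter_left _ fun y hy => ⟨(hGB i hy).1, hGV i y hy⟩), ?_⟩
      rintro ⟨y, ⟨hyB, hyV⟩, hy⟩
      by_contra hne
      exact hyV (hKV (Or.inr (Set.mem_iUnion.2
        ⟨⟨i, Set.not_nonempty_iff_eq_empty.1 hne⟩, hyB, hy⟩)))

end Match

/-! ### Isomorphisms of Boolean rings from matching stratifications -/

namespace StoneSpace

open NonUnitalBooleanRing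

section Cell

variable {R : Type u} [NonUnitalBooleanRing R] {κ : Type w}

/-- The cells of the partition of the Stone space that is generated by a family of compact open
sets: the points that lie in precisely the sets with index in `T`. -/
def cell (f : κ → R) (T : Set κ) : Set (StoneSpace R) := {x | ∀ k, x ∈ basicOpen (f k) ↔ k ∈ T}

theorem eq_of_mem_cell {f : κ → R} {T T' : Set κ} {x : StoneSpace R} (h : x ∈ cell f T)
    (h' : x ∈ cell f T') : T = T' :=
  Set.ext fun k => (h k).symm.trans (h' k)

theorem isClopen_cell [Finite κ] (f : κ → R) (T : Set κ) : IsClopen (cell f T) := by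
  have : cell f T = ⋂ k, {x | x ∈ basicOpen (f k) ↔ k ∈ T} := by
    ext x
    simp [cell]
  rw [this]
  refine isClopen_iInter_of_finite fun k => ?_
  have hk : IsClopen (basicOpen (f k)) := ⟨isClosed_basicOpen _, isOpen_basicOpen _⟩
  by_cases hkT : k ∈ T
  · convert hk using 1
    ext x
    simp [hkT]
  · convert hk.compl using 1
    ext x
    simp [hkT]

theorem mem_cell_insert [DecidableEq κ] (f : κ → R) {s : Finset κ} {p : κ}
    {T : Set ↥(insert p s)} {x : StoneSpace R} :
    x ∈ cell (fun q : ↥(insert p s) => f q.1) T ↔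
      x ∈ cell (fun q : s => f q.1) {q | ⟨q.1, Finset.mem_insert_of_mem q.2⟩ ∈ T} ∧
        (x ∈ basicOpen (f p) ↔ ⟨p, Finset.mem_insert_self p s⟩ ∈ T) := by
  refine ⟨fun hx => ⟨fun q => hx ⟨q.1, Finset.mem_insert_of_mem q.2⟩, hx ⟨p, _⟩⟩, ?_⟩
  rintro ⟨hx, hxp⟩ ⟨q, hq⟩
  obtain rfl | hqs := Finset.mem_insert.1 hq
  exacts [hxp, hx ⟨q, hqs⟩]

end Cell

variable {R : Type u} {S : Type v} [NonUnitalBooleanRing R] [NonUnitalBooleanRing S]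
  {ι : Type w} {D : ι → Set (StoneSpace R)} {E : ι → Set (StoneSpace S)}

/-- If the part of a cell outside a compact open set does not accumulate at a stratum, then the
corresponding part of the matching cell is compact: either the cell is bounded, or else the stratum
is. -/
theorem isCompact_cell_inter_derivedSet (h : StratificationMatch D E) {κ : Type*} [Finite κ]
    {f : κ → R} {g : κ → S} {T : Set κ} {a : R} {i : ι}
    (hi : (cell f T \ basicOpen a) ∩ derivedSet (D i) = ∅) :
    IsCompact (cell g T ∩ derivedSet (E i)) := by
  obtain rfl | ⟨k, hk⟩ := T.eq_empty_or_nonempty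
  · have hcpt : IsCompact ((⋃ k, basicOpen (f k)) ∪ basicOpen a ∪ isolatedPoints (D i)) :=
      ((isCompact_iUnion fun k => isCompact_basicOpen _).union (isCompact_basicOpen a)).union
        (h.left.finite_isolatedPoints i).isCompact
    have hD : IsCompact (closure (D i)) := by
      refine hcpt.of_isClosed_subset isClosed_closure (closure_minimal (fun x hx => ?_)
        hcpt.isClosed)
      by_cases hx' : x ∈ derivedSet (D i)
      · refine Or.inl (by_contra fun hno => ?_)
        rw [Set.mem_union, Set.mem_iUnion, not_or, not_exists] at hno
        exact hi.subset ⟨⟨fun k => by simpa using hno.1 k, hno.2⟩, hx'⟩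
      · exact Or.inr ⟨hx, hx'⟩
    exact ((h.isCompact_iff i).1 hD).of_isClosed_subset
      ((isClopen_cell g ∅).isClosed.inter (isClosed_derivedSet _))
      (Set.inter_subset_right.trans (derivedSet_subset_closure _))
  · exact (isCompact_basicOpen (g k)).of_isClosed_subset
      ((isClopen_cell g T).isClosed.inter (isClosed_derivedSet _))
      fun y hy => (hy.1 k).2 hk

/-- The extension step: a compact open set on one side can be matched on the other side. -/
theorem exists_matching_element [Finite ι] (h : StratificationMatch D E) {κ : Type*} [Finite κ]
    {f : κ → R} {g : κ → S} (hfg : ∀ T, IsSimilar D E (cell f T) (cell g T)) (a : R) :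
    ∃ b : S, ∀ T, IsSimilar D E (cell f T ∩ basicOpen a) (cell g T ∩ basicOpen b) ∧
      IsSimilar D E (cell f T \ basicOpen a) (cell g T \ basicOpen b) := by
  have hA : ∀ T, cell f T \ (cell f T ∩ basicOpen a) = cell f T \ basicOpen a :=
    fun T => Set.sdiff_self_inter
  choose K U hK hU hKU hUB hKUV using fun T => (hfg T).exists_split h (isClopen_cell g T).isOpen
    (P := cell f T ∩ basicOpen a) Set.inter_subset_left
    ((isClopen_cell f T).isOpen.inter (isOpen_basicOpen a))
    (by rw [hA]; exact (isClopen_cell f T).isOpen.sdiff (isClosed_basicOpen a))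
    (fun i hi => isCompact_cell_inter_derivedSet h (by rwa [hA] at hi))
  obtain ⟨b, hKb, hbU⟩ := exists_basicOpen_between (isCompact_iUnion hK) (isOpen_iUnion hU)
    (Set.iUnion_mono hKU)
  refine ⟨b, fun T => ?_⟩
  have hV := hKUV T (cell g T ∩ basicOpen b)
    (Set.subset_inter ((hKU T).trans (hUB T)) ((Set.subset_iUnion K T).trans hKb)) (by
      rintro y ⟨hy, hyb⟩
      obtain ⟨T', hT'⟩ := Set.mem_iUnion.1 (hbU hyb)
      rwa [eq_of_mem_cell hy (hUB T' hT')])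
  rwa [hA, Set.sdiff_self_inter] at hV

/-- Finite partial isomorphisms: finite sets of pairs that generate similar cells. -/
def partialIsos (D : ι → Set (StoneSpace R)) (E : ι → Set (StoneSpace S)) :
    Set (Finset (R × S)) :=
  {s | ∀ T : Set s, IsSimilar D E (cell (fun p : s => p.1.1) T) (cell (fun p : s => p.1.2) T)}

theorem insert_mem_partialIsos [DecidableEq (R × S)] {s : Finset (R × S)} {a : R} {b : S}
    (h : ∀ T : Set s,
      IsSimilar D E (cell (fun p : s => p.1.1) T ∩ basicOpen a)
        (cell (fun p : s => p.1.2) T ∩ basicOpen b) ∧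
      IsSimilar D E (cell (fun p : s => p.1.1) T \ basicOpen a)
        (cell (fun p : s => p.1.2) T \ basicOpen b)) :
    insert (a, b) s ∈ partialIsos D E := by
  intro T
  let T₀ : Set s := {p | (⟨p.1, Finset.mem_insert_of_mem p.2⟩ : ↥(insert (a, b) s)) ∈ T}
  let p₀ : ↥(insert (a, b) s) := ⟨(a, b), Finset.mem_insert_self _ _⟩
  by_cases hp₀ : p₀ ∈ T
  · convert! (h T₀).1 using 1 <;> ext x
    · rw [mem_cell_insert Prod.fst]; simp [T₀, p₀, hp₀]
    · rw [mem_cell_insert Prod.snd]; simp [T₀, p₀, hp₀]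
  · convert! (h T₀).2 using 1 <;> ext x
    · rw [mem_cell_insert Prod.fst]; simp [T₀, p₀, hp₀]
    · rw [mem_cell_insert Prod.snd]; simp [T₀, p₀, hp₀]

/-- Corresponding strata realize the same patterns with respect to a finite partial isomorphism. -/
theorem exists_mem_of_mem_partialIsos (h : StratificationMatch D E) {s : Finset (R × S)}
    (hs : s ∈ partialIsos D E) (y : StoneSpace S) :
    ∃ x : StoneSpace R, (∃ i, x ∈ D i ∧ y ∈ E i) ∧
      ∀ p ∈ s, x ∈ basicOpen p.1 ↔ y ∈ basicOpen p.2 := by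
  obtain ⟨i, hi⟩ := h.right.exists_mem y
  obtain ⟨x, hx, hxi⟩ := ((hs {p | y ∈ basicOpen p.1.2}).inter_nonempty_iff h
    (isClopen_cell _ _).isOpen (isClopen_cell _ _).isOpen i).2 ⟨y, fun p => Iff.rfl, hi⟩
  exact ⟨x, ⟨i, hxi, hi⟩, fun p hp => hx ⟨p, hp⟩⟩

/-- As `exists_mem_of_mem_partialIsos`, with the sides exchanged. -/
theorem exists_mem_of_mem_partialIsos' (h : StratificationMatch D E) {s : Finset (R × S)}
    (hs : s ∈ partialIsos D E) (x : StoneSpace R) :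
    ∃ y : StoneSpace S, (∃ i, x ∈ D i ∧ y ∈ E i) ∧
      ∀ p ∈ s, x ∈ basicOpen p.1 ↔ y ∈ basicOpen p.2 := by
  obtain ⟨i, hi⟩ := h.left.exists_mem x
  obtain ⟨y, hy, hyi⟩ := ((hs {p | x ∈ basicOpen p.1.1}).inter_nonempty_iff h
    (isClopen_cell _ _).isOpen (isClopen_cell _ _).isOpen i).1 ⟨x, fun p => Iff.rfl, hi⟩
  exact ⟨y, ⟨i, hi, hyi⟩, fun p hp => (hy ⟨p, hp⟩).symm⟩

/-- Countable Boolean rings whose Stone spaces carry matching finite stratifications are isomorphic,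
by an isomorphism that respects all ideals whose closed sets are corresponding unions of strata. -/
theorem nonempty_systemIso_of_match [Finite ι] [Countable R] [Countable S]
    (h : StratificationMatch D E) {n : ℕ} {J : Fin n → TwoSidedIdeal R}
    {K : Fin n → TwoSidedIdeal S}
    (hJK : ∀ i k x y, x ∈ D i → y ∈ E i → (x ∈ closedSet (J k) ↔ y ∈ closedSet (K k))) :
    Nonempty (SystemIso J K) := by
  classical
  have hinj : ∀ s ∈ partialIsos D E, ∀ p ∈ s, ∀ q ∈ s, p.1 = q.1 ↔ p.2 = q.2 := by
    intro s hs p hp q hq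
    constructor
    · refine fun hpq => basicOpen_injective (Set.ext fun y => ?_)
      obtain ⟨x, -, hx⟩ := exists_mem_of_mem_partialIsos h hs y
      rw [← hx p hp, ← hx q hq, hpq]
    · refine fun hpq => basicOpen_injective (Set.ext fun x => ?_)
      obtain ⟨y, -, hy⟩ := exists_mem_of_mem_partialIsos' h hs x
      rw [hy p hp, hy q hq, hpq]
  have hempty : (∅ : Finset (R × S)) ∈ partialIsos D E := by
    intro T
    convert! h.isSimilar_univ using 1 <;>
      exact Set.eq_univ_of_forall fun x p => (Finset.notMem_empty _ p.2).elim
  obtain ⟨e, -, he⟩ := exists_equiv_of_back_and_forth (partialIsos D E) hinj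
    (fun s hs a => by
      obtain ⟨b, hb⟩ := exists_matching_element h hs a
      exact ⟨b, _, insert_mem_partialIsos hb, Finset.subset_insert _ _,
        Finset.mem_insert_self _ _⟩)
    (fun s hs b => by
      obtain ⟨a, ha⟩ := exists_matching_element h.symm (fun T => (hs T).symm) b
      exact ⟨a, _, insert_mem_partialIsos fun T => ⟨(ha T).1.symm, (ha T).2.symm⟩,
        Finset.subset_insert _ _, Finset.mem_insert_self _ _⟩)
    hempty
  have hadd : ∀ a b, e (a + b) = e a + e b := fun a b => by
    obtain ⟨s, hs, hts⟩ := he {a, b, a + b}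
    refine basicOpen_injective (Set.ext fun y => ?_)
    obtain ⟨x, -, hx⟩ := exists_mem_of_mem_partialIsos h hs y
    rw [mem_basicOpen_add, ← hx _ (hts a (by simp)), ← hx _ (hts b (by simp)),
      ← hx _ (hts (a + b) (by simp)), mem_basicOpen_add]
  have hmul : ∀ a b, e (a * b) = e a * e b := fun a b => by
    obtain ⟨s, hs, hts⟩ := he {a, b, a * b}
    refine basicOpen_injective (Set.ext fun y => ?_)
    obtain ⟨x, -, hx⟩ := exists_mem_of_mem_partialIsos h hs y
    rw [basicOpen_mul, Set.mem_inter_iff, ← hx _ (hts a (by simp)), ← hx _ (hts b (by simp)),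
      ← hx _ (hts (a * b) (by simp)), basicOpen_mul, Set.mem_inter_iff]
  refine ⟨⟨{ e with map_add' := hadd, map_mul' := hmul }, fun k a => ?_⟩⟩
  change a ∈ J k ↔ e a ∈ K k
  rw [← disjoint_basicOpen_closedSet_iff, ← disjoint_basicOpen_closedSet_iff,
    Set.disjoint_left, Set.disjoint_left]
  obtain ⟨s, hs, hts⟩ := he {a}
  have has := hts a (by simp)
  constructor
  · intro ha y hy hyK
    obtain ⟨x, ⟨i, hxi, hyi⟩, hx⟩ := exists_mem_of_mem_partialIsos h hs y
    exact ha ((hx _ has).2 hy) ((hJK i k x y hxi hyi).2 hyK)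
  · intro ha x hx hxJ
    obtain ⟨y, ⟨i, hxi, hyi⟩, hy⟩ := exists_mem_of_mem_partialIsos' h hs x
    exact ha ((hy _ has).1 hx) ((hJK i k x y hxi hyi).1 hxJ)

end StoneSpace

/-! ### The stratification by the atoms of a finite closure algebra -/

section Atoms

variable {X : Type u} [TopologicalSpace X] {n : ℕ} {C : Fin n → Set X}

theorem exists_atom_mem [Finite (generatedClosureAlgebra C)] (x : X) :
    ∃ D : generatedClosureAlgebra C, IsAtom D ∧ x ∈ (D : Set X) := by
  obtain ⟨D, hxD, hmin⟩ := exists_minimal_of_wellFoundedLT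
    (fun D : generatedClosureAlgebra C => x ∈ (D : Set X)) ⟨⊤, trivial⟩
  refine ⟨D, ⟨fun h => ?_, fun B hBD => ?_⟩, hxD⟩
  · rw [h] at hxD
    exact hxD
  · have hxB : x ∉ (B : Set X) := fun hxB => hBD.not_ge (hmin hxB hBD.le)
    have hle : D ≤ D \ B := hmin (y := D \ B) ⟨hxD, hxB⟩ sdiff_le
    exact disjoint_self.1 ((le_sdiff.1 hle).2.mono_left hBD.le)

theorem le_of_mem_atom {D A : generatedClosureAlgebra C} (hD : IsAtom D) {x : X}
    (hxD : x ∈ (D : Set X)) (hxA : x ∈ (A : Set X)) : D ≤ A := by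
  by_contra h
  have : x ∈ ((D ⊓ A : generatedClosureAlgebra C) : Set X) := ⟨hxD, hxA⟩
  rw [(hD.not_le_iff_disjoint.1 h).eq_bot] at this
  exact this

/-- The atoms of a finite closure algebra form a stratification. -/
theorem isStratification_atoms [Finite (generatedClosureAlgebra C)] {ι : Type w}
    (e : ι ≃ {D : generatedClosureAlgebra C // IsAtom D})
    (hfin : ∀ D : generatedClosureAlgebra C, (isolatedPoints (D : Set X)).Finite) :
    IsStratification fun i => ((e i).1 : Set X) where
  exists_mem x := by
    obtain ⟨D, hD, hx⟩ := exists_atom_mem (C := C) x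
    exact ⟨e.symm ⟨D, hD⟩, by simpa using hx⟩
  eq_of_mem {i j x} hi hj := e.injective (Subtype.ext
    ((le_of_mem_atom (e i).2 hi hj).antisymm (le_of_mem_atom (e j).2 hj hi)))
  subset_closure_of_mem {i j x} hj hi := le_of_mem_atom (A := closureOp C (e i).1) (e j).2 hj hi
  finite_isolatedPoints i := hfin _

theorem finite_iff_of_sizeType_eq {Y : Type v} [TopologicalSpace Y] {A : Set X} {B : Set Y}
    (h : sizeType A = sizeType B) : A.Finite ↔ B.Finite := by
  unfold sizeType at h
  split_ifs at h <;> simp_all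

theorem isCompact_closure_iff_of_sizeType_eq {Y : Type v} [TopologicalSpace Y] [T1Space X]
    [T1Space Y] {A : Set X} {B : Set Y} (h : sizeType A = sizeType B) :
    IsCompact (closure A) ↔ IsCompact (closure B) := by
  have hA : A.Finite → IsCompact (closure A) := fun hf => by
    rw [hf.isClosed.closure_eq]
    exact hf.isCompact
  have hB : B.Finite → IsCompact (closure B) := fun hf => by
    rw [hf.isClosed.closure_eq]
    exact hf.isCompact
  unfold sizeType at h
  split_ifs at h <;> simp_all

/-- An isomorphism of closure data matches the stratifications by atoms. -/
theorem ClosureDataIso.stratificationMatch {Y : Type v} [TopologicalSpace Y] [T1Space X]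
    [T1Space Y] {E : Fin n → Set Y} (θ : ClosureDataIso C E)
    [Finite (generatedClosureAlgebra C)] [Finite (generatedClosureAlgebra E)]
    (hC : ∀ D : generatedClosureAlgebra C, (isolatedPoints (D : Set X)).Finite)
    (hE : ∀ D : generatedClosureAlgebra E, (isolatedPoints (D : Set Y)).Finite) :
    StratificationMatch
      (fun D : {D : generatedClosureAlgebra C // IsAtom D} => (D.1 : Set X))
      (fun D => (θ.toOrderIso D.1 : Set Y)) where
  left := isStratification_atoms (Equiv.refl _) hC
  right := isStratification_atoms
    (θ.toOrderIso.toEquiv.subtypeEquiv fun D => (θ.toOrderIso.isAtom_iff D).symm) hE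
  subset_closure_iff i j := by
    change j.1 ≤ closureOp C i.1 ↔ θ.toOrderIso j.1 ≤ closureOp E (θ.toOrderIso i.1)
    rw [← θ.map_closureOp, θ.toOrderIso.le_iff_le]
  ncard_eq i := (θ.map_numIsolated i.1 i.2).symm
  finite_iff i := finite_iff_of_sizeType_eq (θ.map_sizeType i.1 i.2).symm
  isCompact_iff i := isCompact_closure_iff_of_sizeType_eq (θ.map_sizeType i.1 i.2).symm

end Atoms

theorem mainTheorem5 {n : ℕ} {R : Type u} {S : Type v}
    [NonUnitalBooleanRing R] [NonUnitalBooleanRing S]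
    (J : Fin n → TwoSidedIdeal R) (K : Fin n → TwoSidedIdeal S)
    (hJ : IsOmegaCategoricalSystem J) (hK : IsOmegaCategoricalSystem K) :
    (∀ D : generatedClosureAlgebra (fun i => StoneSpace.closedSet (J i)),
        IsAtom D → (isolatedPoints (D : Set (StoneSpace R))).Finite) ∧
      (Nonempty (ClosureDataIso (fun i => StoneSpace.closedSet (J i))
          (fun i => StoneSpace.closedSet (K i))) →
        Nonempty (SystemIso J K)) := by
  refine ⟨fun D _ => hJ.finite_isolatedPoints D.2, fun ⟨θ⟩ => ?_⟩
  have := hJ.finite_generatedClosureAlgebra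
  have := hK.finite_generatedClosureAlgebra
  have : Countable R := hJ.1
  have : Countable S := hK.1
  refine StoneSpace.nonempty_systemIso_of_match
    (θ.stratificationMatch (fun D => hJ.finite_isolatedPoints D.2)
      fun D => hK.finite_isolatedPoints D.2) fun D k x y hx hy => ?_
  let A := generator (fun i => StoneSpace.closedSet (J i)) k
  let B := generator (fun i => StoneSpace.closedSet (K i)) k
  have hAB : D.1 ≤ A ↔ θ.toOrderIso D.1 ≤ B := by
    rw [show B = θ.toOrderIso A from (θ.map_generator k).symm, θ.toOrderIso.le_iff_le]
  exact ⟨fun hxA => hAB.1 (le_of_mem_atom (A := A) D.2 hx hxA) hy, fun hyB =>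
    hAB.2 (le_of_mem_atom (A := B) ((θ.toOrderIso.isAtom_iff D.1).2 D.2) hy hyB) hx⟩
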